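/- **Proposition.** Let $V_5$ be a $5$-dimensional complex vector space, let $G(2,V_5)\subset\mathbf P(\wedge^2V_5)=\mathbf P^9$ be the Grassmannian in its Plücker embedding, and let $$X=G(2,V_5)\cap\mathbf P^8\cap Q$$ be a non-Gushel fourfold of type $\mathcal X_{10}^0$, that is, a smooth irreducible fourfold which is the (scheme-theoretic) intersection of $G(2,V_5)$ with a hyperplane $\mathbf P^8=\{\omega=0\}$ and a quadric $Q$ of $\mathbf P(\wedge^2V_5)$. Here $\omega\neq 0$ is a linear form on $\wedge^2V_5$, viewed also as a skew-symmetric form on $V_5$. Then: 1. $X$ is unirational: there is a dominant rational map from a projective space to $X$. 2. The kernel $V_1\subset V_5$ of $\omega$ is one-dimensional, and $\Sigma_0:=\mathbf P(V_1\wedge V_5)\cap Q$ is a quadric surface (that is, $\mathbf P(V_1\wedge V_5)\not\subset Q$) contained in $X$. Every irreducible $\sigma$-quadric contained in $X$ is equal to $\Sigma_0$. (An irreducible $\sigma$-quadric is an irreducible quadric surface in a $3$-plane $\mathbf P(V_1'\wedge V_5)$, where $V_1'\subset V_5$ is a line; this $3$-plane parametrizes the lines of $\mathbf P(V_5)$ through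 the point $[V_1']$.) 3. There is a rational double cover $\varphi:\mathbf P^4\dashrightarrow X$, that is, a dominant rational map whose fibre over a general point of $X$ consists of exactly two points. It is built from lines in $G(2,V_5)$ through points of $\Sigma_0$: there is a rational map $s:\mathbf P^4\dashrightarrow\Sigma_0$ such that, for a general point $y\in\mathbf P^4$, the line joining $s(y)$ and $\varphi(y)$ is contained in $G(2,V_5)$ and meets $X\smallsetminus\Sigma_0$ exactly in the point $\varphi(y)$. -/

import Mathlib

open scoped LinearAlgebra.Projectivization

namespace FanoTen

/-! ## Projective varieties and rational maps over the complex numbers -/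

section Projective

variable {E F : Type*} [AddCommGroup E] [Module ℂ E] [AddCommGroup F] [Module ℂ F]

/-- `g` is (the function given by) a homogeneous polynomial of degree `d` on the vector space `E`.
Polynomials are written in linear forms on `E`, so that no basis has to be chosen. -/
def IsHomogeneousPolynomial (d : ℕ) (g : E → ℂ) : Prop :=
  ∃ p : MvPolynomial (Module.Dual ℂ E) ℂ, p.IsHomogeneous d ∧
    ∀ e : E, g e = MvPolynomial.eval (fun l : Module.Dual ℂ E => l e) p

/-- Zariski closed subsets of `ℙ(E)`: common zero loci of homogeneous polynomials. -/
def IsZariskiClosed (Z : Set (ℙ ℂ E)) : Prop :=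
  ∃ S : Set (E → ℂ), (∀ g ∈ S, ∃ d : ℕ, IsHomogeneousPolynomial d g) ∧
    Z = {x | ∀ g ∈ S, g x.rep = 0}

/-- Irreducibility (in particular non-emptiness) for the Zariski topology of `ℙ(E)`. -/
def IsZariskiIrreducible (X : Set (ℙ ℂ E)) : Prop :=
  X.Nonempty ∧ ∀ Z₁ Z₂ : Set (ℙ ℂ E), IsZariskiClosed Z₁ → IsZariskiClosed Z₂ →
    X ⊆ Z₁ ∪ Z₂ → X ⊆ Z₁ ∨ X ⊆ Z₂

/-- `P` holds at a general point of the irreducible set `X`: it holds on a non-empty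
Zariski open subset of `X`. -/
def ForGeneral (X : Set (ℙ ℂ E)) (P : ℙ ℂ E → Prop) : Prop :=
  ∃ Z : Set (ℙ ℂ E), IsZariskiClosed Z ∧ ¬ X ⊆ Z ∧ ∀ x ∈ X, x ∉ Z → P x

/-- A rational map `ℙ(E) ⇢ ℙ(F)`, presented by a polynomial map `E → F`, not identically zero,
whose components are homogeneous polynomials of one and the same degree. -/
structure RationalMap (E F : Type*) [AddCommGroup E] [Module ℂ E]
    [AddCommGroup F] [Module ℂ F] where
  /-- the polynomial map between the vector spaces -/
  toFun : E → F
  /-- the common degree of its components -/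
  degree : ℕ
  homogeneous : ∀ l : Module.Dual ℂ F, IsHomogeneousPolynomial degree (fun e => l (toFun e))
  exists_ne_zero : ∃ e : E, toFun e ≠ 0

/-- The dense open subset of `ℙ(E)` on which the given presentation is defined. -/
def RationalMap.domain (f : RationalMap E F) : Set (ℙ ℂ E) :=
  {y | f.toFun y.rep ≠ 0}

/-- The value of a rational map at a point of `RationalMap.domain`. -/
noncomputable def RationalMap.value (f : RationalMap E F) (y : ℙ ℂ E) (hy : y ∈ f.domain) :
    ℙ ℂ F :=
  Projectivization.mk ℂ (f.toFun y.rep) hy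

/-- `f` is a rational map `ℙ(E) ⇢ X`, for a Zariski closed `X ⊆ ℙ(F)`. -/
def RationalMap.MapsInto (f : RationalMap E F) (X : Set (ℙ ℂ F)) : Prop :=
  ∀ (y : ℙ ℂ E) (hy : y ∈ f.domain), f.value y hy ∈ X

/-- The rational map `f` into `X` is dominant: its image is Zariski dense in `X`. -/
def RationalMap.IsDominantOnto (f : RationalMap E F) (X : Set (ℙ ℂ F)) : Prop :=
  f.MapsInto X ∧ ∀ Z : Set (ℙ ℂ F), IsZariskiClosed Z →
    (∀ (y : ℙ ℂ E) (hy : y ∈ f.domain), f.value y hy ∈ Z) → X ⊆ Z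

/-- The fibre of a rational map over a point. -/
def RationalMap.fiber (f : RationalMap E F) (x : ℙ ℂ F) : Set (ℙ ℂ E) :=
  {y | ∃ hy : y ∈ f.domain, f.value y hy = x}

/-- A rational double cover `ℙ(E) ⇢ X` of an irreducible variety `X`: a dominant rational map of
degree two, that is, one whose fibre over a general point of `X` consists of exactly two points.
(Another presentation of the same map differs from `f` only over a proper closed subset of `X`
once general fibres are finite, so the notion depends on the rational map alone.) -/
def RationalMap.IsRationalDoubleCover (f : RationalMap E F) (X : Set (ℙ ℂ F)) : Prop :=
  f.IsDominantOnto X ∧ ForGeneral X (fun x => (f.fiber x).ncard = 2)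

/-- `X` is unirational: some projective space `ℙⁿ` has a dominant rational map to `X`. -/
def IsUnirational (X : Set (ℙ ℂ F)) : Prop :=
  ∃ (n : ℕ) (f : RationalMap (Fin (n + 1) → ℂ) F), f.IsDominantOnto X

/-- The line spanned by two (distinct) points of a projective space. -/
def lineThrough (a b : ℙ ℂ E) : Set (ℙ ℂ E) :=
  {z | z.rep ∈ Submodule.span ℂ ({a.rep, b.rep} : Set E)}

end Projective

/-! ## Linear and quadratic sections of the Grassmannian of lines -/

section Grassmannian

variable {V : Type*} [AddCommGroup V] [Module ℂ V]

/-- The bivector `u ∧ w`. -/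
noncomputable def wedge (u w : V) : ⋀[ℂ]^2 V := exteriorPower.ιMulti ℂ 2 ![u, w]

/-- The Grassmannian `G(2, V)` in its Plücker embedding: the classes of the nonzero decomposable
bivectors `u ∧ w`; such a class corresponds to the plane spanned by `u` and `w`. -/
def grassmannian (V : Type*) [AddCommGroup V] [Module ℂ V] : Set (ℙ ℂ (⋀[ℂ]^2 V)) :=
  {x | ∃ u w : V, x.rep = wedge u w}

/-- The intersection `X = G(2, V) ∩ {ω = 0} ∩ {q = 0}`. -/
def fourfold (ω : Module.Dual ℂ (⋀[ℂ]^2 V)) (q : QuadraticForm ℂ (⋀[ℂ]^2 V)) :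
    Set (ℙ ℂ (⋀[ℂ]^2 V)) :=
  {x | x ∈ grassmannian V ∧ ω x.rep = 0 ∧ q x.rep = 0}

/-- The Zariski tangent space at `η` of the affine cone over the intersection scheme
`G(2, V) ∩ {ω = 0} ∩ {q = 0}`. The ideal of `G(2, V)` is generated by the Plücker quadrics
`η ∧ η = 0` (with values in `⋀⁴ V`), so that the linearised equations in `ξ` are
`η ∧ ξ = 0`, `ω(ξ) = 0` and `b_q(η, ξ) = 0`, where `b_q` is the polar form of `q`. -/
noncomputable def coneTangentSpace (ω : Module.Dual ℂ (⋀[ℂ]^2 V))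
    (q : QuadraticForm ℂ (⋀[ℂ]^2 V)) (η : ⋀[ℂ]^2 V) : Submodule ℂ (⋀[ℂ]^2 V) :=
  LinearMap.ker ((LinearMap.mulLeft ℂ (η : ExteriorAlgebra ℂ V)).comp (⋀[ℂ]^2 V).subtype)
    ⊓ LinearMap.ker ω ⊓ LinearMap.ker (q.polarBilin η)

/-- `G(2, V) ∩ {ω = 0} ∩ {q = 0}`, the section of the Grassmannian by a hyperplane and a quadric,
is a smooth (irreducible) fourfold. Smoothness is that of the intersection scheme: at every point
the projective Zariski tangent space has dimension `4`, i.e. the one of the cone has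
dimension `5`. -/
structure IsSmoothFourfold (ω : Module.Dual ℂ (⋀[ℂ]^2 V))
    (q : QuadraticForm ℂ (⋀[ℂ]^2 V)) : Prop where
  hyperplane : ω ≠ 0
  quadric : q ≠ 0
  irreducible : IsZariskiIrreducible (fourfold ω q)
  smooth : ∀ x ∈ fourfold ω q, Module.finrank ℂ (coneTangentSpace ω q x.rep) = 5

/-- The line spanned by `v ≠ 0` is the kernel of the skew-symmetric form
`(u, w) ↦ ω (u ∧ w)` on `V`. -/
def SpansKernel (ω : Module.Dual ℂ (⋀[ℂ]^2 V)) (v : V) : Prop :=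
  v ≠ 0 ∧ ∀ u : V, (∀ w : V, ω (wedge u w) = 0) ↔ u ∈ Submodule.span ℂ {v}

/-- The subspace `v ∧ V` of bivectors; `ℙ(v ∧ V)` parametrises the lines of `ℙ(V)` through the
point `[v]`. -/
noncomputable def star (v : V) : Submodule ℂ (⋀[ℂ]^2 V) :=
  Submodule.span ℂ (Set.range (wedge v))

/-- The set `ℙ(v ∧ V) ∩ {r = 0}`. -/
def sigmaQuadric (v : V) (r : QuadraticForm ℂ (⋀[ℂ]^2 V)) : Set (ℙ ℂ (⋀[ℂ]^2 V)) :=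
  {x | x.rep ∈ star v ∧ r x.rep = 0}

/-- `S` is an irreducible `σ`-quadric: it is the zero locus in some `ℙ(v ∧ V)` of a quadratic form
which is not a product of two linear forms (in particular not zero) on `v ∧ V`. -/
def IsIrreducibleSigmaQuadric (S : Set (ℙ ℂ (⋀[ℂ]^2 V))) : Prop :=
  ∃ (v : V) (r : QuadraticForm ℂ (⋀[ℂ]^2 V)), v ≠ 0 ∧
    (¬ ∃ l m : Module.Dual ℂ (⋀[ℂ]^2 V), ∀ η ∈ star v, r η = l η * m η) ∧
    S = sigmaQuadric v r

/-- `φ : ℙ(E) ⇢ X` is built from lines in `G(2, V)` through points of `S ⊆ X`: there is a rational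
map `s : ℙ(E) ⇢ S` such that, for general `y`, the line joining the points `s(y)` and `φ(y)` lies
in `G(2, V)` and `φ(y)` is the only point of this line on `X` outside `S`. -/
def IsBuiltFromLines {E : Type*} [AddCommGroup E] [Module ℂ E]
    (φ : RationalMap E (⋀[ℂ]^2 V)) (X S : Set (ℙ ℂ (⋀[ℂ]^2 V))) : Prop :=
  ∃ s : RationalMap E (⋀[ℂ]^2 V), s.MapsInto S ∧
    ForGeneral (Set.univ : Set (ℙ ℂ E)) (fun y =>
      ∃ (hs : y ∈ s.domain) (hφ : y ∈ φ.domain),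
        lineThrough (s.value y hs) (φ.value y hφ) ⊆ grassmannian V ∧
        {z | z ∈ lineThrough (s.value y hs) (φ.value y hφ) ∧ z ∈ X ∧ z ∉ S} = {φ.value y hφ})

end Grassmannian

end FanoTen

namespace FanoTen

/-! ### Bivectors: bilinearity of the wedge and contraction with linear forms. -/

section Wedge

variable {V : Type*} [AddCommGroup V] [Module ℂ V]

/-! Let v span the kernel of ω, put Q(u) = q(v ∧ u), a quadratic form on V/⟨v⟩ whose zeros give Σ₀,
and let B be the polar form of q. A general point of X is an ω-isotropic plane ⟨a, b⟩ on which Q has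
exactly two zeros [u]; for each of them the line joining v ∧ u to a ∧ b lies in the Grassmannian.
Conversely, if Q(u) = 0, w is ω-orthogonal to u and ξ = u ∧ w, then the line joining v ∧ u to ξ lies
in the Grassmannian and in the hyperplane. Since q(v ∧ u) = 0, it meets the quadric in one further
point, q(ξ) v ∧ u - B(v ∧ u, ξ) ξ, which is `Chart.cover`. So X is dominated with degree two by a
ℙ¹-bundle over the threefold cone Q = 0 in ℙ(V), with fibre ℙ(u^⊥/⟨u, v⟩); `Chart.transversal`
trivialises it over an open set.

It remains to parametrise this bundle by ℙ⁴ = ℙ(V). If Q is not a product of linear forms, project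
the cone from one of its points e₀ and let the position on the line through e₀ give the fibre
coordinate (`Chart.count_of_projection`). If Q = l m, use only the hyperplane l = 0: a general plane
meets it in a single line, which would give degree one, and squaring the fibre coordinate restores
degree two (`Chart.count_of_hyperplane`).

The fibre count needs several open conditions on the point of X. Each is the nonvanishing of a
homogeneous polynomial in the bivector. As X is irreducible, each may be tested at a point of its
own (`GenericallyNonzero.mul`).

Smoothness enters three times, always by producing a singular point: ω has rank four
(`IsSmoothFourfold.exists_kernel`); Q is not a square (`IsSmoothFourfold.not_square`), hence is
nondegenerate on some isotropic plane; and for some isotropic pair the conic cut by q on ⋀²⟨v, a, b⟩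
is smooth (`IsSmoothFourfold.exists_gram_ne_zero`).

Finally, ω cannot be nonzero on the 3-plane of an irreducible σ-quadric contained in X, since the
quadric would then be a double plane. So that 3-plane is ℙ(v ∧ V), and a Nullstellensatz for
quadrics identifies the two equations (`eq_sigmaQuadric`). -/

theorem coe_wedge (u w : V) :
    ((wedge u w : ⋀[ℂ]^2 V) : ExteriorAlgebra ℂ V)
      = ExteriorAlgebra.ι ℂ u * ExteriorAlgebra.ι ℂ w := by
  simp [wedge, ExteriorAlgebra.ιMulti_apply]

/-- The bilinear map `(u, w) ↦ u ∧ w`. -/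
noncomputable def wedgeB (V : Type*) [AddCommGroup V] [Module ℂ V] : V →ₗ[ℂ] V →ₗ[ℂ] ⋀[ℂ]^2 V :=
  LinearMap.mk₂ ℂ wedge
    (fun a b c => Subtype.ext (by simp [coe_wedge, add_mul]))
    (fun r a c => Subtype.ext (by simp [coe_wedge]))
    (fun a b c => Subtype.ext (by simp [coe_wedge, mul_add]))
    (fun r a c => Subtype.ext (by simp [coe_wedge]))

theorem wedgeB_apply (u w : V) : wedgeB V u w = wedge u w := rfl

theorem wedge_self (u : V) : wedge u u = 0 :=
  Subtype.ext (by simp [coe_wedge])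

theorem wedge_add_left (a b c : V) : wedge (a + b) c = wedge a c + wedge b c := by
  simp [← wedgeB_apply]

theorem wedge_add_right (a b c : V) : wedge a (b + c) = wedge a b + wedge a c := by
  simp [← wedgeB_apply]

theorem wedge_sub_right (a b c : V) : wedge a (b - c) = wedge a b - wedge a c := by
  simp [← wedgeB_apply]

theorem wedge_smul_left (r : ℂ) (a b : V) : wedge (r • a) b = r • wedge a b := by
  simp [← wedgeB_apply]

theorem wedge_smul_right (r : ℂ) (a b : V) : wedge a (r • b) = r • wedge a b := by
  simp [← wedgeB_apply]

theorem wedge_neg_right (a b : V) : wedge a (-b) = -wedge a b := by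
  simp [← wedgeB_apply]

theorem wedge_zero_left (a : V) : wedge 0 a = 0 := by
  simp [← wedgeB_apply]

theorem wedge_zero_right (a : V) : wedge a 0 = 0 := by
  simp [← wedgeB_apply]

theorem wedge_swap (a b : V) : wedge b a = -wedge a b := by
  have h := wedge_self (a + b)
  rw [wedge_add_left, wedge_add_right, wedge_add_right, wedge_self, wedge_self] at h
  rw [zero_add, add_zero] at h
  exact eq_neg_of_add_eq_zero_right h

/-- The linear map on bivectors induced by an alternating bilinear map. -/
noncomputable def liftWedge {N : Type*} [AddCommGroup N] [Module ℂ N] (C : V →ₗ[ℂ] V →ₗ[ℂ] N)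
    (hC : ∀ x, C x x = 0) : ⋀[ℂ]^2 V →ₗ[ℂ] N :=
  exteriorPower.alternatingMapLinearEquiv
    { toFun := fun m => C (m 0) (m 1)
      map_update_add' := by
        intro _ m i x y
        fin_cases i <;> simp [Function.update]
      map_update_smul' := by
        intro _ m i c x
        fin_cases i <;> simp [Function.update]
      map_eq_zero_of_eq' := by
        intro m i j h hij
        have h01 : m 0 = m 1 := by
          fin_cases i <;> fin_cases j <;> simp_all
        simp [h01, hC] }

@[simp]
theorem liftWedge_wedge {N : Type*} [AddCommGroup N] [Module ℂ N] (C : V →ₗ[ℂ] V →ₗ[ℂ] N)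
    (hC : ∀ x, C x x = 0) (u w : V) : liftWedge C hC (wedge u w) = C u w := by
  simp [liftWedge, wedge]

/-- Contraction of bivectors with a linear form, as a bilinear map. -/
noncomputable def contract (V : Type*) [AddCommGroup V] [Module ℂ V] :
    Module.Dual ℂ V →ₗ[ℂ] (⋀[ℂ]^2 V) →ₗ[ℂ] V where
  toFun f := liftWedge ((LinearMap.lsmul ℂ V).comp f - ((LinearMap.lsmul ℂ V).comp f).flip)
    (fun x => by simp)
  map_add' f g := by
    apply exteriorPower.linearMap_ext
    ext m
    have : exteriorPower.ιMulti ℂ 2 m = wedge (m 0) (m 1) := by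
      unfold wedge; congr 1; ext i; fin_cases i <;> rfl
    simp only [LinearMap.compAlternatingMap_apply, this, LinearMap.add_apply, liftWedge_wedge]
    simp; abel
  map_smul' r f := by
    apply exteriorPower.linearMap_ext
    ext m
    have : exteriorPower.ιMulti ℂ 2 m = wedge (m 0) (m 1) := by
      unfold wedge; congr 1; ext i; fin_cases i <;> rfl
    simp only [LinearMap.compAlternatingMap_apply, this, LinearMap.smul_apply, liftWedge_wedge]
    simp [mul_smul, smul_sub]

@[simp]
theorem contract_wedge (f : Module.Dual ℂ V) (a b : V) :
    contract V f (wedge a b) = f a • b - f b • a := by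
  simp [contract]

theorem exists_dual_eq_one {a b : V} (h : LinearIndependent ℂ ![a, b]) :
    ∃ f : Module.Dual ℂ V, f a = 1 ∧ f b = 0 := by
  have ha : a ∉ Submodule.span ℂ {b} := by
    intro ha
    obtain ⟨c, hc⟩ := Submodule.mem_span_singleton.mp ha
    have := LinearIndependent.pair_iff.mp h 1 (-c) (by simp [hc])
    simp at this
  obtain ⟨f, hf, hfb⟩ := Submodule.exists_dual_map_eq_bot_of_notMem ha inferInstance
  refine ⟨(f a)⁻¹ • f, by simp [hf], ?_⟩
  have : f b ∈ (Submodule.span ℂ {b}).map f :=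
    Submodule.mem_map_of_mem (Submodule.mem_span_singleton_self b)
  rw [hfb, Submodule.mem_bot] at this
  simp [this]

theorem wedge_ne_zero {a b : V} (h : LinearIndependent ℂ ![a, b]) : wedge a b ≠ 0 := by
  intro h0
  obtain ⟨f, hfa, hfb⟩ : ∃ f : Module.Dual ℂ V, f a = 1 ∧ f b = 0 := by
    exact exists_dual_eq_one h
  have := congrArg (contract V f) h0
  simp [hfa, hfb] at this
  exact h.ne_zero 1 this

end Wedge

/-! ### Calculus of homogeneous polynomial maps without coordinates. -/

section Polynomial

variable {E F : Type*} [AddCommGroup E] [Module ℂ E] [AddCommGroup F] [Module ℂ F]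

namespace IsHomogeneousPolynomial

variable {d d' : ℕ} {g g' : E → ℂ}

theorem of_linear (l : Module.Dual ℂ E) : IsHomogeneousPolynomial 1 (fun e => l e) :=
  ⟨MvPolynomial.X l, MvPolynomial.isHomogeneous_X _ _, fun e => by simp⟩

theorem mul (h : IsHomogeneousPolynomial d g) (h' : IsHomogeneousPolynomial d' g') :
    IsHomogeneousPolynomial (d + d') (fun e => g e * g' e) := by
  obtain ⟨p, hp, hg⟩ := h
  obtain ⟨p', hp', hg'⟩ := h'
  exact ⟨p * p', hp.mul hp', fun e => by simp [hg, hg']⟩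

theorem add (h : IsHomogeneousPolynomial d g) (h' : IsHomogeneousPolynomial d g') :
    IsHomogeneousPolynomial d (fun e => g e + g' e) := by
  obtain ⟨p, hp, hg⟩ := h
  obtain ⟨p', hp', hg'⟩ := h'
  exact ⟨p + p', hp.add hp', fun e => by simp [hg, hg']⟩

theorem const_mul (c : ℂ) (h : IsHomogeneousPolynomial d g) :
    IsHomogeneousPolynomial d (fun e => c * g e) := by
  obtain ⟨p, hp, hg⟩ := h
  exact ⟨MvPolynomial.C c * p, hp.C_mul c, fun e => by simp [hg]⟩

theorem sum {ι : Type*} (s : Finset ι) (G : ι → E → ℂ)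
    (h : ∀ i ∈ s, IsHomogeneousPolynomial d (G i)) :
    IsHomogeneousPolynomial d (fun e => ∑ i ∈ s, G i e) := by
  choose! p hp hg using h
  exact ⟨∑ i ∈ s, p i, MvPolynomial.IsHomogeneous.sum _ _ _ hp, fun e => by
    rw [map_sum]; exact Finset.sum_congr rfl fun i hi => hg i hi e⟩

theorem map_smul (h : IsHomogeneousPolynomial d g) (c : ℂ) (e : E) : g (c • e) = c ^ d * g e := by
  obtain ⟨p, hp, hg⟩ := h
  rw [hg, hg, MvPolynomial.eval_eq, MvPolynomial.eval_eq, Finset.mul_sum]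
  refine Finset.sum_congr rfl fun m hm => ?_
  have hd : ∑ i ∈ m.support, m i = d := by
    have := hp (MvPolynomial.mem_support_iff.mp hm)
    rw [← this, Finsupp.weight_apply, Finsupp.sum]
    simp
  simp only [_root_.map_smul, smul_eq_mul, mul_pow, Finset.prod_mul_distrib,
    Finset.prod_pow_eq_pow_sum, hd]
  ring

end IsHomogeneousPolynomial

/-- `G` is a polynomial map all of whose components are homogeneous of degree `d`. -/
def IsHomogeneousMap (d : ℕ) (G : E → F) : Prop :=
  ∀ l : Module.Dual ℂ F, IsHomogeneousPolynomial d (fun e => l (G e))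

namespace IsHomogeneousMap

variable {F₁ F₂ : Type*} [AddCommGroup F₁] [Module ℂ F₁] [AddCommGroup F₂] [Module ℂ F₂]
  {d d' : ℕ}

theorem of_linear (A : E →ₗ[ℂ] F) : IsHomogeneousMap 1 (fun e => A e) :=
  fun l => IsHomogeneousPolynomial.of_linear (l.comp A)

theorem polynomial {g : E → ℂ} (h : IsHomogeneousMap d g) : IsHomogeneousPolynomial d g :=
  h LinearMap.id

theorem linear_comp {G : E → F} (h : IsHomogeneousMap d G) (A : F →ₗ[ℂ] F₁) :
    IsHomogeneousMap d (fun e => A (G e)) :=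
  fun l => h (l.comp A)

theorem add {G G' : E → F} (h : IsHomogeneousMap d G) (h' : IsHomogeneousMap d G') :
    IsHomogeneousMap d (fun e => G e + G' e) := fun l => by
  simpa using (h l).add (h' l)

theorem neg {G : E → F} (h : IsHomogeneousMap d G) : IsHomogeneousMap d (fun e => -G e) :=
  fun l => by simpa using (h l).const_mul (-1)

theorem sub {G G' : E → F} (h : IsHomogeneousMap d G) (h' : IsHomogeneousMap d G') :
    IsHomogeneousMap d (fun e => G e - G' e) := by
  simpa [sub_eq_add_neg] using h.add h'.neg

/-- Expanding the first argument in a finite basis turns the value into a finite sum of products of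
components. -/
theorem bilinear [Module.Finite ℂ F₁] (B : F₁ →ₗ[ℂ] F₂ →ₗ[ℂ] F) {G₁ : E → F₁} {G₂ : E → F₂}
    (h₁ : IsHomogeneousMap d G₁) (h₂ : IsHomogeneousMap d' G₂) :
    IsHomogeneousMap (d + d') (fun e => B (G₁ e) (G₂ e)) := by
  intro l
  let b := Module.finBasis ℂ F₁
  have : (fun e => l (B (G₁ e) (G₂ e)))
      = fun e => ∑ i, b.coord i (G₁ e) * (l.comp (B (b i))) (G₂ e) := by
    funext e
    conv_lhs => rw [← b.sum_repr (G₁ e)]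
    simp only [map_sum, LinearMap.map_smul, LinearMap.sum_apply, LinearMap.smul_apply, smul_eq_mul,
      Module.Basis.coord_apply, LinearMap.comp_apply]
  rw [this]
  exact IsHomogeneousPolynomial.sum _ _ fun i _ => (h₁ (b.coord i)).mul (h₂ (l.comp (B (b i))))

theorem smul {g : E → ℂ} {G : E → F} (h : IsHomogeneousMap d g) (h' : IsHomogeneousMap d' G) :
    IsHomogeneousMap (d + d') (fun e => g e • G e) :=
  bilinear (LinearMap.lsmul ℂ F) h h'

theorem quadratic [Module.Finite ℂ F₁] (r : QuadraticForm ℂ F₁) {G : E → F₁}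
    (h : IsHomogeneousMap d G) : IsHomogeneousMap (d + d) (fun e => r (G e)) := by
  have : (fun e => r (G e)) = fun e => ((1 / 2 : ℂ) • r.polarBilin) (G e) (G e) := by
    funext e
    simp [QuadraticMap.polar_self]
  rw [this]
  exact bilinear _ h h

theorem map_smul {G : E → F} (h : IsHomogeneousMap d G) (c : ℂ) (e : E) :
    G (c • e) = c ^ d • G e := by
  rw [← sub_eq_zero]
  refine (Module.forall_dual_apply_eq_zero_iff ℂ _).mp fun l => ?_
  have := (h l).map_smul c e
  simp [this]

end IsHomogeneousMap

end Polynomial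

/-! ### Elementary facts on quadratic and linear forms. -/

section Quadratic

variable {W : Type*} [AddCommGroup W] [Module ℂ W]

theorem quad_add (q : QuadraticForm ℂ W) (x y : W) : q (x + y) = q x + q y + q.polarBilin x y := by
  simp [QuadraticMap.polar]

theorem quad_smul (q : QuadraticForm ℂ W) (c : ℂ) (x : W) : q (c • x) = c ^ 2 * q x := by
  rw [QuadraticMap.map_smul, smul_eq_mul]; ring

theorem polarBilin_self (q : QuadraticForm ℂ W) (x : W) : q.polarBilin x x = 2 * q x := by
  simp [QuadraticMap.polar_self]

theorem polarBilin_comm (q : QuadraticForm ℂ W) (x y : W) :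
    q.polarBilin x y = q.polarBilin y x := by
  simp [QuadraticMap.polar_comm]

theorem exists_quadratic_root {a : ℂ} (ha : a ≠ 0) (b c : ℂ) : ∃ x : ℂ, a * x ^ 2 + b * x + c = 0 := by
  obtain ⟨s, hs⟩ := IsAlgClosed.exists_eq_mul_self (discrim a b c)
  obtain ⟨x, hx⟩ := exists_quadratic_eq_zero ha ⟨s, hs⟩
  exact ⟨x, by linear_combination hx⟩

theorem exists_smul_eq_of_ker_le (f g : Module.Dual ℂ W) (h : ∀ x, f x = 0 → g x = 0) :
    ∃ c : ℂ, ∀ x, g x = c * f x := by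
  by_cases hf : ∃ x, f x ≠ 0
  · obtain ⟨x₀, hx₀⟩ := hf
    refine ⟨g x₀ / f x₀, fun x => ?_⟩
    have := h (x - (f x / f x₀) • x₀) (by simp [hx₀])
    simp only [map_sub, map_smul, smul_eq_mul] at this
    field_simp at this ⊢
    linear_combination this
  · push Not at hf
    exact ⟨0, fun x => by simp [h x (hf x)]⟩

end Quadratic

/-! ### Representatives of projective points. -/

section Projective

variable {E : Type*} [AddCommGroup E] [Module ℂ E]

theorem exists_rep_mk (e : E) (he : e ≠ 0) :
    ∃ c : ℂ, c ≠ 0 ∧ (Projectivization.mk ℂ e he).rep = c • e := by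
  obtain ⟨a, ha⟩ := Projectivization.exists_smul_eq_mk_rep ℂ e he
  exact ⟨a, a.ne_zero, ha.symm⟩

end Projective

/-! ### Smoothness as independence of two equations on the tangent space of the Grassmannian. -/

section Geometry

variable {V : Type*} [AddCommGroup V] [Module ℂ V]

theorem mk_mem_fourfold {ω : Module.Dual ℂ (⋀[ℂ]^2 V)} {q : QuadraticForm ℂ (⋀[ℂ]^2 V)} {a b : V}
    (h : wedge a b ≠ 0) (hω : ω (wedge a b) = 0) (hq : q (wedge a b) = 0) :
    Projectivization.mk ℂ (wedge a b) h ∈ fourfold ω q := by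
  obtain ⟨c, -, hc⟩ := exists_rep_mk _ h
  refine ⟨⟨c • a, b, by rw [hc, wedge_smul_left]⟩, ?_, ?_⟩
  · rw [hc]; simp [hω]
  · rw [hc, quad_smul, hq, mul_zero]

theorem finrank_le_finrank_inf_ker_add_one {W : Type*} [AddCommGroup W] [Module ℂ W]
    [Module.Finite ℂ W] (R : Submodule ℂ W) (f : Module.Dual ℂ W) :
    Module.finrank ℂ R ≤ Module.finrank ℂ (R ⊓ LinearMap.ker f : Submodule ℂ W) + 1 := by
  have h1 := Submodule.finrank_sup_add_finrank_inf_eq R (LinearMap.ker f)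
  have h2 := Submodule.finrank_le (R ⊔ LinearMap.ker f)
  have h3 := LinearMap.finrank_range_add_finrank_ker f
  have h4 := Submodule.finrank_le (LinearMap.range f)
  rw [Module.finrank_self] at h4
  omega

/-- The bivectors `a ∧ y + b ∧ z`: the tangent space of the cone over the Grassmannian. -/
noncomputable def tangentMap (a b : V) : V × V →ₗ[ℂ] ⋀[ℂ]^2 V :=
  (wedgeB V a).coprod (wedgeB V b)

theorem tangentMap_apply (a b y z : V) : tangentMap a b (y, z) = wedge a y + wedge b z := by
  simp [tangentMap, wedgeB_apply]

/-- Contracting a ∧ y + b ∧ z = 0 with forms dual to a and b puts y and z in ⟨a, b⟩ and shows that f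
y, f z and g z determine the pair. The kernel thus has dimension at most 3, and 10 - 3 = 7. -/
theorem seven_le_finrank_range_tangentMap (hV : Module.finrank ℂ V = 5) {a b : V}
    (hab : LinearIndependent ℂ ![a, b]) :
    7 ≤ Module.finrank ℂ (LinearMap.range (tangentMap a b)) := by
  have : Module.Finite ℂ V := Module.finite_of_finrank_pos (by omega)
  obtain ⟨f, hfa, hfb⟩ := exists_dual_eq_one hab
  obtain ⟨g, hgb, hga⟩ := exists_dual_eq_one (LinearIndependent.pair_symm_iff.mp hab)
  let P : V × V →ₗ[ℂ] Fin 3 → ℂ :=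
    LinearMap.pi ![f.comp (LinearMap.fst ℂ V V), f.comp (LinearMap.snd ℂ V V),
      g.comp (LinearMap.snd ℂ V V)]
  have hker : Module.finrank ℂ (LinearMap.ker (tangentMap a b)) ≤ 3 := by
    have hinj : Function.Injective (P.domRestrict (LinearMap.ker (tangentMap a b))) := by
      rw [← LinearMap.ker_eq_bot, LinearMap.ker_eq_bot']
      rintro ⟨⟨y, z⟩, hm⟩ h
      rw [LinearMap.mem_ker, tangentMap_apply] at hm
      have h0 : f y = 0 := congrFun h 0
      have h1 : f z = 0 := congrFun h 1
      have h2 : g z = 0 := congrFun h 2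
      have e1 := congrArg (contract V f) hm
      have e2 := congrArg (contract V g) hm
      simp [hfa, hfb, h0, h1] at e1
      subst e1
      simp [hgb, h2] at e2
      subst e2
      rfl
    simpa using LinearMap.finrank_le_finrank_of_injective hinj
  have h1 := LinearMap.finrank_range_add_finrank_ker (tangentMap a b)
  rw [Module.finrank_prod, hV] at h1
  omega

/-- At a point `a ∧ b` of a smooth fourfold the two equations are independent on the tangent space
of the Grassmannian. -/
theorem IsSmoothFourfold.tangent_independent (hV : Module.finrank ℂ V = 5)
    {ω : Module.Dual ℂ (⋀[ℂ]^2 V)} {q : QuadraticForm ℂ (⋀[ℂ]^2 V)} (hX : IsSmoothFourfold ω q)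
    {a b : V} (hab : LinearIndependent ℂ ![a, b]) (hω : ω (wedge a b) = 0)
    (hq : q (wedge a b) = 0) {α β : ℂ}
    (h : ∀ y z, α * ω (wedge a y + wedge b z)
      + β * q.polarBilin (wedge a b) (wedge a y + wedge b z) = 0) : α = 0 ∧ β = 0 := by
  have : Module.Finite ℂ V := Module.finite_of_finrank_pos (by omega)
  have hne := wedge_ne_zero hab
  have hsm := hX.smooth _ (mk_mem_fourfold hne hω hq)
  obtain ⟨c, hc0, hc⟩ := exists_rep_mk _ hne
  rw [hc] at hsm
  have hR := seven_le_finrank_range_tangentMap hV hab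
  set R := LinearMap.range (tangentMap a b)
  -- If a single equation f implied both others on R, the tangent space of the cone would contain R
  -- ∩ ker f, of dimension at least 6, instead of having dimension 5.
  have key : ∀ f : Module.Dual ℂ (⋀[ℂ]^2 V),
      (∀ ξ ∈ R, f ξ = 0 → ω ξ = 0 ∧ q.polarBilin (wedge a b) ξ = 0) → False := by
    intro f hf
    have hle : R ⊓ LinearMap.ker f ≤ coneTangentSpace ω q (c • wedge a b) := by
      rintro ξ ⟨hξ, hfξ⟩
      obtain ⟨h1, h2⟩ := hf ξ hξ hfξ
      refine ⟨⟨?_, h1⟩, ?_⟩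
      · obtain ⟨⟨y, z⟩, rfl⟩ := hξ
        rw [tangentMap_apply, SetLike.mem_coe, LinearMap.mem_ker]
        simp only [LinearMap.comp_apply, Submodule.subtype_apply, LinearMap.mulLeft_apply,
          Submodule.coe_smul, Submodule.coe_add, coe_wedge, smul_mul_assoc]
        have e1 : ExteriorAlgebra.ι ℂ a * ExteriorAlgebra.ι ℂ b
            = -(ExteriorAlgebra.ι ℂ b * ExteriorAlgebra.ι ℂ a) :=
          eq_neg_of_add_eq_zero_left (ExteriorAlgebra.ι_add_mul_swap a b)
        have t1 : ExteriorAlgebra.ι ℂ a * ExteriorAlgebra.ι ℂ b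
            * (ExteriorAlgebra.ι ℂ a * ExteriorAlgebra.ι ℂ y) = 0 := by
          rw [e1, neg_mul, mul_assoc, ← mul_assoc (ExteriorAlgebra.ι ℂ a) (ExteriorAlgebra.ι ℂ a),
            ExteriorAlgebra.ι_sq_zero, zero_mul, mul_zero, neg_zero]
        have t2 : ExteriorAlgebra.ι ℂ a * ExteriorAlgebra.ι ℂ b
            * (ExteriorAlgebra.ι ℂ b * ExteriorAlgebra.ι ℂ z) = 0 := by
          rw [mul_assoc, ← mul_assoc (ExteriorAlgebra.ι ℂ b) (ExteriorAlgebra.ι ℂ b),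
            ExteriorAlgebra.ι_sq_zero, zero_mul, mul_zero]
        rw [mul_add, t1, t2, add_zero, smul_zero]
      · rw [SetLike.mem_coe, LinearMap.mem_ker, map_smul, LinearMap.smul_apply, h2, smul_zero]
    have h6 := Submodule.finrank_mono hle
    have h7 := finrank_le_finrank_inf_ker_add_one R f
    omega
  have hR' : ∀ ξ ∈ R, α * ω ξ + β * q.polarBilin (wedge a b) ξ = 0 := by
    rintro ξ ⟨⟨y, z⟩, rfl⟩
    rw [tangentMap_apply]
    exact h y z
  by_cases hβ : β = 0
  · refine ⟨?_, hβ⟩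
    by_contra hα
    refine key (q.polarBilin (wedge a b)) fun ξ hξ h0 => ⟨?_, h0⟩
    have := hR' ξ hξ
    rw [hβ, zero_mul, add_zero] at this
    exact (mul_eq_zero.mp this).resolve_left hα
  · exfalso
    refine key ω fun ξ hξ h0 => ⟨h0, ?_⟩
    have := hR' ξ hξ
    rw [h0, mul_zero, zero_add] at this
    exact (mul_eq_zero.mp this).resolve_left hβ

/-- Variant: some tangent vector in the hyperplane is not tangent to the quadric. -/
theorem IsSmoothFourfold.exists_tangent (hV : Module.finrank ℂ V = 5)
    {ω : Module.Dual ℂ (⋀[ℂ]^2 V)} {q : QuadraticForm ℂ (⋀[ℂ]^2 V)} (hX : IsSmoothFourfold ω q)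
    {a b : V} (hab : LinearIndependent ℂ ![a, b]) (hω : ω (wedge a b) = 0)
    (hq : q (wedge a b) = 0) :
    ∃ y z, ω (wedge a y + wedge b z) = 0 ∧
      q.polarBilin (wedge a b) (wedge a y + wedge b z) ≠ 0 := by
  by_contra! hcon
  obtain ⟨c, hc⟩ := exists_smul_eq_of_ker_le (ω.comp (tangentMap a b))
    ((q.polarBilin (wedge a b)).comp (tangentMap a b)) (by
      rintro ⟨y, z⟩ h
      simp only [LinearMap.comp_apply, tangentMap_apply] at h ⊢
      exact hcon y z h)
  have := hX.tangent_independent hV hab hω hq (α := -c) (β := 1) (fun y z => by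
    have := hc (y, z)
    simp only [LinearMap.comp_apply, tangentMap_apply] at this
    rw [this]; ring)
  exact one_ne_zero this.2

end Geometry

/-! ### Alternating forms on a five-dimensional space: frames and isotropic pairs. -/

section Alternating

variable {V : Type*} [AddCommGroup V] [Module ℂ V]

theorem alt_swap {A : V →ₗ[ℂ] V →ₗ[ℂ] ℂ} (hA : ∀ x, A x x = 0) (x y : V) : A y x = -A x y := by
  have h := hA (x + y)
  simp only [map_add, LinearMap.add_apply, hA] at h
  linear_combination h

/-- Two orthogonal hyperbolic pairs `(t, t')`, `(w, w')` for an alternating form. -/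
structure IsFrame (A : V →ₗ[ℂ] V →ₗ[ℂ] ℂ) (t w t' w' : V) : Prop where
  tt' : A t t' = 1
  ww' : A w w' = 1
  tw : A t w = 0
  tw' : A t w' = 0
  wt' : A w t' = 0
  t'w' : A t' w' = 0

/-- The four functionals A(·, t'), A(·, w'), A(t, ·), A(w, ·) are dual to t, w, t', w'. They map V
onto ℂ⁴, so their common kernel is a line, and subtracting the frame components of u lands in it. -/
theorem IsFrame.exists_kernel (hV : Module.finrank ℂ V = 5) {A : V →ₗ[ℂ] V →ₗ[ℂ] ℂ}
    (hA : ∀ x, A x x = 0) {t w t' w' : V} (h : IsFrame A t w t' w') :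
    ∃ v, v ≠ 0 ∧ (∀ u, A v u = 0) ∧
      ∀ u, ∃ s : ℂ, u = s • v + A u t' • t + A u w' • w + A t u • t' + A w u • w' := by
  have : Module.Finite ℂ V := Module.finite_of_finrank_pos (by omega)
  obtain ⟨h1, h2, h3, h4, h5, h6⟩ := h
  have g3 := alt_swap hA t w
  have g6 := alt_swap hA t' w'
  rw [h3] at g3
  rw [h6] at g6
  let Ψ : V →ₗ[ℂ] Fin 4 → ℂ := LinearMap.pi ![A.flip t', A.flip w', A t, A w]
  have hsurj : Function.Surjective Ψ := by
    intro x
    refine ⟨x 0 • t + x 1 • w + x 2 • t' + x 3 • w', ?_⟩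
    ext i
    fin_cases i <;> simp [Ψ, hA, h1, h2, h3, h4, h5, h6, g3, g6]
  have hk : Module.finrank ℂ (LinearMap.ker Ψ) = 1 := by
    have := LinearMap.finrank_range_add_finrank_ker Ψ
    rw [LinearMap.range_eq_top.mpr hsurj, finrank_top, hV] at this
    simp at this
    omega
  obtain ⟨⟨v, hv⟩, hv0, hspan⟩ := finrank_eq_one_iff'.mp hk
  have hexp : ∀ u, ∃ s : ℂ,
      u = s • v + A u t' • t + A u w' • w + A t u • t' + A w u • w' := by
    intro u
    have hu : u - (A u t' • t + A u w' • w + A t u • t' + A w u • w') ∈ LinearMap.ker Ψ := by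
      rw [LinearMap.mem_ker]
      ext i
      fin_cases i <;> simp [Ψ, hA, h1, h2, h3, h4, h5, h6, g3, g6]
    obtain ⟨s, hs⟩ := hspan ⟨_, hu⟩
    have hs' : s • v = u - (A u t' • t + A u w' • w + A t u • t' + A w u • w') :=
      congrArg Subtype.val hs
    refine ⟨s, ?_⟩
    rw [hs']
    abel
  have hv' : Ψ v = 0 := hv
  have k0 : A v t' = 0 := congrFun hv' 0
  have k1 : A v w' = 0 := congrFun hv' 1
  have k2 : A t v = 0 := congrFun hv' 2
  have k3 : A w v = 0 := congrFun hv' 3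
  have k2' : A v t = 0 := by rw [alt_swap hA, k2, neg_zero]
  have k3' : A v w = 0 := by rw [alt_swap hA, k3, neg_zero]
  refine ⟨v, fun h => hv0 (Subtype.ext h), fun u => ?_, hexp⟩
  obtain ⟨s, hs⟩ := hexp u
  rw [hs]
  simp [hA, k0, k1, k2', k3']

variable {A : V →ₗ[ℂ] V →ₗ[ℂ] ℂ} {v : V}

/-- Expansion with respect to a frame, modulo a given kernel vector. -/
theorem IsFrame.expand (hV : Module.finrank ℂ V = 5) (hA : ∀ x, A x x = 0)
    (hK : ∀ u, (∀ x, A u x = 0) → u ∈ Submodule.span ℂ {v}) {t w t' w' : V}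
    (h : IsFrame A t w t' w') (u : V) :
    ∃ s : ℂ, u = s • v + A u t' • t + A u w' • w + A t u • t' + A w u • w' := by
  obtain ⟨v', -, hv', hexp⟩ := h.exists_kernel hV hA
  obtain ⟨c, rfl⟩ := Submodule.mem_span_singleton.mp (hK v' hv')
  obtain ⟨s, hs⟩ := hexp u
  exact ⟨s * c, by rwa [mul_smul]⟩

/-- An isotropic pair, independent modulo the kernel, is part of a frame. -/
theorem exists_frame (hA : ∀ x, A x x = 0)
    (hK : ∀ u, (∀ x, A u x = 0) → u ∈ Submodule.span ℂ {v}) {t w : V} (htw : A t w = 0)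
    (hind : ∀ α β : ℂ, α • t + β • w ∈ Submodule.span ℂ {v} → α = 0 ∧ β = 0) :
    ∃ t' w', IsFrame A t w t' w' := by
  have key : ∀ t w : V, (∀ α β : ℂ, α • t + β • w ∈ Submodule.span ℂ {v} → α = 0 ∧ β = 0) →
      ∃ x, A t x = 0 ∧ A w x = 1 := by
    intro t w hind
    by_contra! hcon
    obtain ⟨c, hc⟩ := exists_smul_eq_of_ker_le (A t) (A w) (fun x hx => by
      by_contra hwx
      exact hcon ((A w x)⁻¹ • x) (by simp [hx]) (by simp [hwx]))
    have := hind (-c) 1 (hK _ fun x => by simp [hc])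
    exact one_ne_zero this.2
  obtain ⟨w', h1, h2⟩ := key t w hind
  obtain ⟨t', h3, h4⟩ := key w t (fun α β h => (hind β α (by rwa [add_comm])).symm)
  -- The multiple of w makes t' orthogonal to w' and, w being isotropic to t and to itself, changes
  -- no other pairing.
  refine ⟨t' - A t' w' • w, w', by simp [h4, htw], h2, htw, h1, by simp [h3, hA], by simp [h2]⟩

/-- A vector outside of the kernel has an isotropic partner. -/
theorem exists_isotropic (hV : Module.finrank ℂ V = 5) {t : V}
    (ht : t ∉ Submodule.span ℂ {v}) :
    ∃ w, A t w = 0 ∧ ∀ α β : ℂ, α • t + β • w ∈ Submodule.span ℂ {v} → α = 0 ∧ β = 0 := by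
  have : Module.Finite ℂ V := Module.finite_of_finrank_pos (by omega)
  -- The orthogonal of t has dimension at least 4, so it is not contained in ⟨t, v⟩.
  have h1 : ¬ LinearMap.ker (A t) ≤ Submodule.span ℂ {t, v} := by
    intro hle
    have h2 := Submodule.finrank_mono hle
    have h3 := finrank_le_finrank_inf_ker_add_one (⊤ : Submodule ℂ V) (A t)
    rw [top_inf_eq, finrank_top, hV] at h3
    classical
    have h4 := finrank_span_finset_le_card (R := ℂ) ({t, v} : Finset V)
    have h5 := Finset.card_le_two (a := t) (b := v)
    rw [Finset.coe_pair, Set.finrank] at h4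
    omega
  obtain ⟨w, hw, hw'⟩ := Set.not_subset.mp h1
  refine ⟨w, hw, fun α β h => ?_⟩
  obtain ⟨c, hc⟩ := Submodule.mem_span_singleton.mp h
  have hβ : β = 0 := by
    by_contra hβ
    apply hw'
    have : w = (-(β⁻¹ * α)) • t + (β⁻¹ * c) • v := by
      rw [mul_smul, hc, smul_add, smul_smul, smul_smul, inv_mul_cancel₀ hβ]
      module
    rw [this]
    exact Submodule.add_mem _ (Submodule.smul_mem _ _ (Submodule.subset_span (by simp)))
      (Submodule.smul_mem _ _ (Submodule.subset_span (by simp)))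
  subst hβ
  refine ⟨?_, rfl⟩
  by_contra hα
  apply ht
  rw [zero_smul, add_zero] at hc
  refine Submodule.mem_span_singleton.mpr ⟨α⁻¹ * c, ?_⟩
  rw [mul_smul, hc, smul_smul, inv_mul_cancel₀ hα, one_smul]

end Alternating

/-! ### The skew form of a smooth fourfold has a one-dimensional kernel. -/

section Kernel

variable {V : Type*} [AddCommGroup V] [Module ℂ V]

/-- The skew form on `V` associated with a linear form on bivectors. -/
noncomputable def skew (ω : Module.Dual ℂ (⋀[ℂ]^2 V)) : V →ₗ[ℂ] V →ₗ[ℂ] ℂ :=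
  (wedgeB V).compr₂ ω

theorem skew_apply (ω : Module.Dual ℂ (⋀[ℂ]^2 V)) (u w : V) : skew ω u w = ω (wedge u w) := rfl

theorem skew_self (ω : Module.Dual ℂ (⋀[ℂ]^2 V)) (u : V) : skew ω u u = 0 := by
  rw [skew_apply, wedge_self, map_zero]

theorem exists_skew_ne_zero {ω : Module.Dual ℂ (⋀[ℂ]^2 V)} (hω : ω ≠ 0) :
    ∃ e f, skew ω e f ≠ 0 := by
  by_contra! h
  apply hω
  apply exteriorPower.linearMap_ext
  ext m
  have : exteriorPower.ιMulti ℂ 2 m = wedge (m 0) (m 1) := by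
    unfold wedge; congr 1; ext i; fin_cases i <;> rfl
  simp only [LinearMap.compAlternatingMap_apply, this]
  exact h _ _

/-- A quadric meets the space of bivectors of any three-dimensional space. -/
theorem exists_wedge_root (q : QuadraticForm ℂ (⋀[ℂ]^2 V)) (P : Submodule ℂ V)
    (hP : 3 ≤ Module.finrank ℂ P) :
    ∃ a ∈ P, ∃ b ∈ P, LinearIndependent ℂ ![a, b] ∧ q (wedge a b) = 0 := by
  have : Module.Finite ℂ P := Module.finite_of_finrank_pos (by omega)
  let B := Module.finBasis ℂ P
  have hB : LinearIndependent ℂ (fun i : Fin 3 => (B (Fin.castLE hP i) : V)) :=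
    (B.linearIndependent.comp _ (Fin.castLE_injective hP)).map' P.subtype (by simp)
  set a := (B (Fin.castLE hP 0) : V)
  set c := (B (Fin.castLE hP 1) : V)
  set d := (B (Fin.castLE hP 2) : V)
  have hB' : ∀ x y z : ℂ, x • a + y • c + z • d = 0 → x = 0 ∧ y = 0 ∧ z = 0 := by
    intro x y z h
    have := Fintype.linearIndependent_iff.mp hB ![x, y, z] (by
      rw [Fin.sum_univ_three]; exact h)
    exact ⟨this 0, this 1, this 2⟩
  have haP : a ∈ P := (B _).2
  have hcP : c ∈ P := (B _).2
  have hdP : d ∈ P := (B _).2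
  by_cases hac : q (wedge a c) = 0
  · refine ⟨a, haP, c, hcP, LinearIndependent.pair_iff.mpr fun x y h => ?_, hac⟩
    have := hB' x y 0 (by rw [h]; simp)
    exact ⟨this.1, this.2.1⟩
  · obtain ⟨s, hs⟩ := exists_quadratic_root hac (q.polarBilin (wedge a d) (wedge a c))
      (q (wedge a d))
    refine ⟨a, haP, d + s • c, P.add_mem hdP (P.smul_mem _ hcP),
      LinearIndependent.pair_iff.mpr fun x y h => ?_, ?_⟩
    · have := hB' x (y * s) y (by rw [← h]; module)
      exact ⟨this.1, this.2.2⟩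
    · rw [wedge_add_right, wedge_smul_right, quad_add, quad_smul, map_smul, smul_eq_mul]
      linear_combination hs

/-- The skew form of a smooth fourfold has rank four. -/
theorem IsSmoothFourfold.exists_kernel (hV : Module.finrank ℂ V = 5)
    {ω : Module.Dual ℂ (⋀[ℂ]^2 V)} {q : QuadraticForm ℂ (⋀[ℂ]^2 V)} (hX : IsSmoothFourfold ω q) :
    ∃ v, v ≠ 0 ∧ (∀ u, skew ω v u = 0) ∧
      ∀ u, (∀ x, skew ω u x = 0) → u ∈ Submodule.span ℂ {v} := by
  have : Module.Finite ℂ V := Module.finite_of_finrank_pos (by omega)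
  have hA := skew_self ω
  set A := skew ω with hAdef
  obtain ⟨e, f', hef'⟩ := exists_skew_ne_zero hX.hyperplane
  rw [← hAdef] at hef'
  obtain ⟨f, hef⟩ : ∃ f, A e f = 1 := ⟨(A e f')⁻¹ • f', by simp [hef']⟩
  clear hef' f'
  -- P is the orthogonal of a hyperbolic plane. If A is nonzero on P, a second hyperbolic pair
  -- completes a frame; otherwise P lies in the kernel of A.
  set P : Submodule ℂ V := LinearMap.ker (A e) ⊓ LinearMap.ker (A f) with hP
  have hmem : ∀ x, x ∈ P ↔ A e x = 0 ∧ A f x = 0 := fun x => by simp [hP]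
  have hfe : A f e = -1 := by rw [alt_swap hA, hef]
  by_cases hPP : ∃ x ∈ P, ∃ y ∈ P, A x y ≠ 0
  · obtain ⟨x, hx, y, hy, hxy⟩ := hPP
    rw [hmem] at hx hy
    have hframe : IsFrame A e x f ((A x y)⁻¹ • y) :=
      ⟨hef, by simp [hxy], hx.1, by simp [hy.1], by rw [alt_swap hA, hx.2, neg_zero],
        by simp [hy.2]⟩
    obtain ⟨v, hv0, hv, hexp⟩ := hframe.exists_kernel hV hA
    refine ⟨v, hv0, hv, fun u hu => ?_⟩
    obtain ⟨s, hs⟩ := hexp u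
    rw [alt_swap hA u e, alt_swap hA u x] at hs
    simp only [hu, neg_zero, zero_smul, add_zero] at hs
    rw [hs]
    exact Submodule.smul_mem _ _ (Submodule.mem_span_singleton_self v)
  · exfalso
    push Not at hPP
    have hPA : ∀ x ∈ P, ∀ u, A x u = 0 := by
      intro x hx u
      have hx' := (hmem x).mp hx
      have hu : u - (A u f • e - A u e • f) ∈ P := by
        rw [hmem]
        simp only [map_sub, map_smul, smul_eq_mul, hef, hfe, hA, alt_swap hA u e, alt_swap hA u f]
        constructor <;> ring
      have := hPP x hx _ hu
      have h1 : A x e = 0 := by rw [alt_swap hA, hx'.1, neg_zero]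
      have h2 : A x f = 0 := by rw [alt_swap hA, hx'.2, neg_zero]
      simpa [h1, h2] using this
    have hP3 : 3 ≤ Module.finrank ℂ P := by
      have h1 := finrank_le_finrank_inf_ker_add_one (⊤ : Submodule ℂ V) (A e)
      have h2 := finrank_le_finrank_inf_ker_add_one (LinearMap.ker (A e)) (A f)
      rw [top_inf_eq, finrank_top, hV] at h1
      rw [hP]
      omega
    -- At such a point a ∧ b of X the form ω vanishes on the whole tangent space a ∧ V + b ∧ V of
    -- the Grassmannian cone.
    obtain ⟨a, ha, b, hb, hab, hq⟩ := exists_wedge_root q P hP3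
    have := hX.tangent_independent hV hab (hPA a ha b) hq (α := 1) (β := 0) (fun y z => by
      have h1 := hPA a ha y
      have h2 := hPA b hb z
      rw [hAdef, skew_apply] at h1 h2
      rw [map_add, h1, h2]; simp)
    exact one_ne_zero this.1

end Kernel

/-! ### Roots of explicit cubics and quintics. -/

theorem exists_root_of_natDegree_ne_zero (p : Polynomial ℂ) (h : p.natDegree ≠ 0) :
    ∃ x, p.eval x = 0 :=
  IsAlgClosed.exists_root p fun hd => h (Polynomial.natDegree_eq_of_degree_eq_some hd)

theorem exists_cubic_root {c₃ : ℂ} (h : c₃ ≠ 0) (c₂ c₁ c₀ : ℂ) :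
    ∃ x : ℂ, c₃ * x ^ 3 + c₂ * x ^ 2 + c₁ * x + c₀ = 0 := by
  have hd := Polynomial.natDegree_cubic (b := c₂) (c := c₁) (d := c₀) h
  obtain ⟨x, hx⟩ := exists_root_of_natDegree_ne_zero _ (by rw [hd]; norm_num)
  exact ⟨x, by simpa using hx⟩

theorem exists_quintic_root {c₅ : ℂ} (h : c₅ ≠ 0) (c₄ c₃ c₂ c₁ c₀ : ℂ) :
    ∃ x : ℂ, c₅ * x ^ 5 + c₄ * x ^ 4 + c₃ * x ^ 3 + c₂ * x ^ 2 + c₁ * x + c₀ = 0 := by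
  open Polynomial in
  have hd : (C c₅ * X ^ 5 + C c₄ * X ^ 4 + C c₃ * X ^ 3 + C c₂ * X ^ 2 + C c₁ * X + C c₀ :
      Polynomial ℂ).natDegree = 5 := by
    compute_degree!
  obtain ⟨x, hx⟩ := exists_root_of_natDegree_ne_zero _ (by rw [hd]; norm_num)
  exact ⟨x, by simpa using hx⟩

/-- Eliminating a leaves a quintic in b with leading coefficient -α A₂². This solves the two
equations for a singular point in `IsSmoothFourfold.not_square`. -/
theorem exists_root_substitution {A₂ α : ℂ} (hA : A₂ ≠ 0) (hα : α ≠ 0)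
    (A₁ A₀ k₁ k₂ k₃ t₂ t₁ t₀ : ℂ) :
    ∃ a b : ℂ, a = A₂ * b ^ 2 + A₁ * b + A₀ ∧
      a ^ 2 * (k₁ - α * b) + a * (k₂ * b + k₃) + t₂ * b ^ 2 + t₁ * b + t₀ = 0 := by
  obtain ⟨b, hb⟩ := exists_quintic_root (c₅ := -α * A₂ ^ 2) (by simp [hA, hα])
    (k₁ * A₂ ^ 2 - 2 * α * A₂ * A₁)
    (2 * k₁ * A₂ * A₁ - α * (A₁ ^ 2 + 2 * A₂ * A₀) + k₂ * A₂)
    (k₁ * (A₁ ^ 2 + 2 * A₂ * A₀) - 2 * α * A₁ * A₀ + k₂ * A₁ + k₃ * A₂ + t₂)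
    (2 * k₁ * A₁ * A₀ - α * A₀ ^ 2 + k₂ * A₀ + k₃ * A₁ + t₁)
    (k₁ * A₀ ^ 2 + k₃ * A₀ + t₀)
  exact ⟨_, b, rfl, by linear_combination hb⟩

/-! ### The form Q is not a square. -/

section Degeneracy

variable {V : Type*} [AddCommGroup V] [Module ℂ V]

theorem exists_notMem_span_singleton (hV : Module.finrank ℂ V = 5) (v : V) :
    ∃ t, t ∉ Submodule.span ℂ {v} := by
  have : Module.Finite ℂ V := Module.finite_of_finrank_pos (by omega)
  by_contra! h
  have h1 : Submodule.span ℂ {v} = ⊤ := by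
    rw [eq_top_iff]; exact fun x _ => h x
  have h2 := finrank_span_finset_le_card (R := ℂ) ({v} : Finset V)
  rw [Finset.coe_singleton, Set.finrank, h1, finrank_top, hV, Finset.card_singleton] at h2
  omega

/-- Linear forms vanishing on the kernel are represented by the alternating form. -/
theorem exists_alt_eq (hV : Module.finrank ℂ V = 5) {A : V →ₗ[ℂ] V →ₗ[ℂ] ℂ}
    (hA : ∀ x, A x x = 0) {v : V} (hK : ∀ u, (∀ x, A u x = 0) → u ∈ Submodule.span ℂ {v})
    (l : Module.Dual ℂ V) (hl : l v = 0) : ∃ h, ∀ u, A h u = l u := by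
  obtain ⟨t, ht⟩ := exists_notMem_span_singleton hV v
  obtain ⟨w, htw, hind⟩ := exists_isotropic hV ht
  obtain ⟨t', w', hF⟩ := exists_frame hA hK htw hind
  refine ⟨l t' • t + l w' • w - l t • t' - l w • w', fun u => ?_⟩
  obtain ⟨s, hs⟩ := hF.expand hV hA hK u
  have := congrArg l hs
  simp only [map_add, map_smul, smul_eq_mul, hl] at this
  simp only [map_add, map_sub, map_smul, LinearMap.add_apply, LinearMap.sub_apply,
    LinearMap.smul_apply, smul_eq_mul, alt_swap hA u t', alt_swap hA u w']
  rw [this]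
  ring

theorem pair_linearIndependent {v u : V} (hv : v ≠ 0) (hu : u ∉ Submodule.span ℂ {v}) :
    LinearIndependent ℂ ![v, u] := by
  refine LinearIndependent.pair_iff.mpr fun x y h => ?_
  have hy : y = 0 := by
    by_contra hy
    apply hu
    refine Submodule.mem_span_singleton.mpr ⟨-(y⁻¹ * x), ?_⟩
    have : u = y⁻¹ • (y • u) := by rw [smul_smul, inv_mul_cancel₀ hy, one_smul]
    rw [this, eq_neg_of_add_eq_zero_right h]
    module
  subst hy
  simp only [zero_smul, add_zero, smul_eq_zero, hv, or_false] at h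
  exact ⟨h, rfl⟩

/-- The restriction of the quadric to `v ∧ V` is not the square of a linear form. -/
theorem IsSmoothFourfold.not_square (hV : Module.finrank ℂ V = 5)
    {ω : Module.Dual ℂ (⋀[ℂ]^2 V)} {q : QuadraticForm ℂ (⋀[ℂ]^2 V)} (hX : IsSmoothFourfold ω q)
    {v : V} (hv0 : v ≠ 0) (hv : ∀ u, skew ω v u = 0)
    (hK : ∀ u, (∀ x, skew ω u x = 0) → u ∈ Submodule.span ℂ {v})
    (l : Module.Dual ℂ V) (hl : ∀ u, q (wedge v u) = l u ^ 2) : False := by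
  have hA := skew_self ω
  have hb : ∀ u y, q.polarBilin (wedge v u) (wedge v y) = 2 * l u * l y := by
    intro u y
    have h1 := hl (u + y)
    rw [wedge_add_right, quad_add, hl, hl, map_add] at h1
    linear_combination h1
  have hlv : l v = 0 := by
    have := hl v
    rw [wedge_self, QuadraticMap.map_zero] at this
    exact pow_eq_zero_iff two_ne_zero |>.mp this.symm
  -- For l ≠ 0, h represents l through ω; for l = 0, any vector off the kernel will do. Thus v ∧ u
  -- lies on X for every u orthogonal to h and not in ⟨v⟩.
  obtain ⟨h, hh, hhl⟩ : ∃ h, h ∉ Submodule.span ℂ {v} ∧ ∀ u, skew ω h u = 0 → l u = 0 := by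
    by_cases hl0 : ∀ u, l u = 0
    · obtain ⟨h, hh⟩ := exists_notMem_span_singleton hV v
      exact ⟨h, hh, fun u _ => hl0 u⟩
    · obtain ⟨h, hh⟩ := exists_alt_eq hV hA hK l hlv
      refine ⟨h, fun hmem => hl0 fun u => ?_, fun u hu => by rw [← hh, hu]⟩
      obtain ⟨c, rfl⟩ := Submodule.mem_span_singleton.mp hmem
      rw [← hh, map_smul, LinearMap.smul_apply, hv, smul_zero]
  -- Smoothness at v ∧ u: tangent directions v ∧ y are invisible to both ω and the polar form, since
  -- l u = 0, so the transverse direction must be some u ∧ z.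
  have star : ∀ u, skew ω h u = 0 → u ∉ Submodule.span ℂ {v} →
      ∃ z, skew ω u z = 0 ∧ q.polarBilin (wedge v u) (wedge u z) ≠ 0 := by
    intro u hu huv
    have hlu := hhl u hu
    obtain ⟨y, z, h1, h2⟩ := hX.exists_tangent hV (pair_linearIndependent hv0 huv) (hv u)
      (by rw [hl, hlu]; ring)
    have h3 := hv y
    rw [skew_apply] at h3
    rw [map_add, h3, zero_add] at h1
    rw [map_add, hb, hlu, mul_zero, zero_mul, zero_add] at h2
    exact ⟨z, h1, h2⟩
  have hTv : ∀ u, skew ω h u = 0 → q.polarBilin (wedge v u) (wedge u v) = 0 := by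
    intro u hu
    rw [wedge_swap v u, map_neg, hb, hhl u hu]; ring
  obtain ⟨z, hz, hτ⟩ := star h (hA h) hh
  set τ := q.polarBilin (wedge v h) (wedge h z) with hτdef
  have hind : ∀ α β : ℂ, α • h + β • z ∈ Submodule.span ℂ {v} → α = 0 ∧ β = 0 := by
    intro α β hmem
    obtain ⟨c, hc⟩ := Submodule.mem_span_singleton.mp hmem
    have := congrArg (fun x => q.polarBilin (wedge v h) (wedge h x)) hc
    simp only [wedge_add_right, wedge_smul_right, map_add, map_smul, smul_eq_mul, wedge_self,
      map_zero, mul_zero, zero_add, hTv h (hA h), ← hτdef] at this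
    have hβ : β = 0 := (mul_eq_zero.mp this.symm).resolve_right hτ
    refine ⟨?_, hβ⟩
    by_contra hα
    apply hh
    rw [hβ, zero_smul, add_zero] at hc
    exact Submodule.mem_span_singleton.mpr ⟨α⁻¹ * c, by
      rw [mul_smul, hc, smul_smul, inv_mul_cancel₀ hα, one_smul]⟩
  obtain ⟨h', z₀, hF₀⟩ := exists_frame hA hK hz hind
  -- Subtracting a multiple of z, possible because τ ≠ 0, removes one coefficient; this keeps the
  -- first equation below linear in a.
  obtain ⟨z', hF, hz'⟩ : ∃ z', IsFrame (skew ω) h z h' z' ∧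
      q.polarBilin (wedge v h) (wedge h z') = 0 := by
    refine ⟨z₀ - (q.polarBilin (wedge v h) (wedge h z₀) / τ) • z,
      ⟨hF₀.tt', by simp [hF₀.ww', hA], hF₀.tw, by simp [hF₀.tw', hF₀.tw], hF₀.wt', ?_⟩, ?_⟩
    · simp [hF₀.t'w', alt_swap hA z h', hF₀.wt']
    · rw [wedge_sub_right, wedge_smul_right, map_sub, map_smul, ← hτdef, smul_eq_mul,
        div_mul_cancel₀ _ hτ, sub_self]
  clear hF₀ z₀
  have g : skew ω z' z = -1 := by rw [alt_swap hA, hF.ww']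
  have g2 : skew ω z' h = 0 := by rw [alt_swap hA, hF.tw', neg_zero]
  have g3 : skew ω z' h' = 0 := by rw [alt_swap hA, hF.t'w', neg_zero]
  have g4 : skew ω z h = 0 := by rw [alt_swap hA, hz, neg_zero]
  set α := q.polarBilin (wedge v z') (wedge h z') with hα
  have notspan : ∀ u x, skew ω u x ≠ 0 → u ∉ Submodule.span ℂ {v} := by
    intro u x hux hmem
    obtain ⟨c, rfl⟩ := Submodule.mem_span_singleton.mp hmem
    exact hux (by rw [map_smul, LinearMap.smul_apply, hv, smul_zero])
  -- It remains to contradict `star` by a vector u in h^⊥ with B(v ∧ u, u ∧ y) = 0 for all y in u^⊥.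
  -- Conceptually, this is a section of the rank-two bundle (u^⊥/⟨u, v⟩)^*(2) on the plane
  -- ℙ(h^⊥/⟨v⟩), and c₂ = 5 forces a zero. It is found explicitly, on the line through h and z' if α
  -- = 0, and in the chart a h + b z' + z otherwise.
  by_cases hα0 : α = 0
  -- With u = a h + z', the functional already kills h because α = 0. The other direction of u^⊥ is
  -- h' + a z, and its value is this cubic in a.
  · obtain ⟨a, ha⟩ := exists_cubic_root hτ
      (q.polarBilin (wedge v h) (wedge h h') + q.polarBilin (wedge v h) (wedge z' z)
        + q.polarBilin (wedge v z') (wedge h z))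
      (q.polarBilin (wedge v h) (wedge z' h') + q.polarBilin (wedge v z') (wedge h h')
        + q.polarBilin (wedge v z') (wedge z' z))
      (q.polarBilin (wedge v z') (wedge z' h'))
    have hu : skew ω h (a • h + z') = 0 := by simp [hA, hF.tw']
    obtain ⟨y, hy, hTy⟩ := star (a • h + z') hu (notspan _ z (by simp [hz, g]))
    apply hTy
    obtain ⟨s, hs⟩ := hF.expand hV hA hK y
    set y₁ := skew ω y h'
    set y₂ := skew ω y z'
    set y₃ := skew ω h y
    set y₄ := skew ω z y
    have e : y₂ = a * y₃ := by
      rw [hs] at hy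
      simp [hF.tt', hF.tw', hz, hA, g, g2, g3, alt_swap hA v, hv] at hy
      linear_combination -hy
    have hT := hTv _ hu
    rw [hs]
    simp only [wedge_add_right, wedge_add_left, wedge_smul_right, wedge_smul_left, map_add,
      LinearMap.add_apply, map_smul, LinearMap.smul_apply, smul_eq_mul, wedge_self,
      map_zero, mul_zero, zero_add, add_zero, wedge_swap h z', map_neg, hz', ← hα, hα0,
      ← hτdef, e] at hT ⊢
    linear_combination y₃ * ha + s * hT
  · obtain ⟨a, b, ha, hroot⟩ := exists_root_substitution (A₂ := -(α / τ)) (α := α)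
      (by simp [hα0, hτ]) hα0
      (-((q.polarBilin (wedge v z) (wedge h z') + q.polarBilin (wedge v z') (wedge h z)) / τ))
      (-(q.polarBilin (wedge v z) (wedge h z) / τ))
      (q.polarBilin (wedge v h) (wedge h h') - q.polarBilin (wedge v z) (wedge h z')
        + q.polarBilin (wedge v h) (wedge z' z))
      (q.polarBilin (wedge v h) (wedge z' h') + q.polarBilin (wedge v z') (wedge h h')
        + q.polarBilin (wedge v z') (wedge z' z))
      (q.polarBilin (wedge v h) (wedge z h') + q.polarBilin (wedge v z) (wedge h h')
        + q.polarBilin (wedge v z) (wedge z' z))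
      (q.polarBilin (wedge v z') (wedge z' h'))
      (q.polarBilin (wedge v z') (wedge z h') + q.polarBilin (wedge v z) (wedge z' h'))
      (q.polarBilin (wedge v z) (wedge z h'))
    -- This says that the functional kills h; `hroot` says that it kills h' - a z'. Together with u
    -- and v these span u^⊥.
    have ha' : a * τ + α * b ^ 2
        + (q.polarBilin (wedge v z) (wedge h z') + q.polarBilin (wedge v z') (wedge h z)) * b
        + q.polarBilin (wedge v z) (wedge h z) = 0 := by
      rw [ha]; field_simp; ring
    have hu : skew ω h (a • h + b • z' + z) = 0 := by simp [hA, hF.tw', hz]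
    obtain ⟨y, hy, hTy⟩ := star (a • h + b • z' + z) hu
      (notspan _ z' (by simp [hF.tw', hF.ww', hA]))
    apply hTy
    obtain ⟨s, hs⟩ := hF.expand hV hA hK y
    set y₁ := skew ω y h'
    set y₂ := skew ω y z'
    set y₃ := skew ω h y
    set y₄ := skew ω z y
    have e : y₄ = b * y₂ - a * y₃ := by
      rw [hs] at hy
      simp [hF.tt', hF.tw', hz, hA, g, g2, g3, g4, hF.wt', hF.ww', alt_swap hA v, hv] at hy
      linear_combination hy
    have hT := hTv _ hu
    rw [hs]
    simp only [wedge_add_right, wedge_add_left, wedge_smul_right, wedge_smul_left, map_add,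
      LinearMap.add_apply, map_smul, LinearMap.smul_apply, smul_eq_mul, wedge_self,
      map_zero, mul_zero, zero_add, add_zero, wedge_swap h z', wedge_swap h z, wedge_swap z' z,
      map_neg, hz', ← hα, ← hτdef, e] at hT ⊢
    linear_combination y₃ * hroot + s * hT + (-y₁ + a * y₂) * ha'

end Degeneracy

/-! ### Isotropic planes on which Q, and then the conic cut by q, are nondegenerate. -/

section Discriminant

variable {V : Type*} [AddCommGroup V] [Module ℂ V]

/-- A quadratic form on `V / ⟨v⟩` which is degenerate on all isotropic planes is a square. -/
theorem exists_isotropic_discriminant_ne_zero (hV : Module.finrank ℂ V = 5)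
    {A : V →ₗ[ℂ] V →ₗ[ℂ] ℂ} (hA : ∀ x, A x x = 0) {v : V}
    (hK : ∀ u, (∀ x, A u x = 0) → u ∈ Submodule.span ℂ {v}) (Q : QuadraticForm ℂ V)
    (hQv : Q v = 0) (hBv : ∀ u, Q.polarBilin v u = 0)
    (hQ : ∀ l : Module.Dual ℂ V, ¬ ∀ u, Q u = l u ^ 2) :
    ∃ a b, A a b = 0 ∧ 4 * Q a * Q b - Q.polarBilin a b ^ 2 ≠ 0 := by
  by_contra! hD
  obtain ⟨t, ht⟩ : ∃ t, Q t ≠ 0 := by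
    by_contra! h
    exact hQ 0 fun u => by simp [h]
  have htv : t ∉ Submodule.span ℂ {v} := by
    intro hmem
    obtain ⟨c, rfl⟩ := Submodule.mem_span_singleton.mp hmem
    exact ht (by rw [quad_smul, hQv, mul_zero])
  obtain ⟨w, htw, hind⟩ := exists_isotropic hV htv
  obtain ⟨s₀, k₀, hF₀⟩ := exists_frame hA hK htw hind
  -- Both k₁ and k₂ are made Q-orthogonal to t by subtracting their projections, as Q t ≠ 0; the
  -- correction to s keeps the frame relations.
  obtain ⟨k₁, s, k₂, hF, hk₁, hk₂⟩ : ∃ k₁ s k₂, IsFrame A t k₁ s k₂ ∧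
      Q.polarBilin t k₁ = 0 ∧ Q.polarBilin t k₂ = 0 := by
    set c₁ := Q.polarBilin t w / (2 * Q t) with hc₁
    set c₂ := Q.polarBilin t k₀ / (2 * Q t) with hc₂
    have e3 := alt_swap hA t w
    have e4 := alt_swap hA t k₀
    have e5 := alt_swap hA w s₀
    have e1 := alt_swap hA t s₀
    rw [hF₀.tw] at e3
    rw [hF₀.tw'] at e4
    rw [hF₀.wt'] at e5
    rw [hF₀.tt'] at e1
    have e6 := alt_swap hA w k₀
    rw [hF₀.ww'] at e6
    have e7 := alt_swap hA s₀ k₀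
    rw [hF₀.t'w'] at e7
    refine ⟨w - c₁ • t, s₀ - c₂ • (w - c₁ • t) + c₁ • (k₀ - c₂ • t), k₀ - c₂ • t, ⟨?_, ?_, ?_, ?_,
      ?_, ?_⟩, ?_, ?_⟩
    · simp [hA, hF₀.tt', hF₀.tw, hF₀.tw']
    · simp [hA, hF₀.ww', hF₀.tw', e3]
    · simp [hA, hF₀.tw]
    · simp [hA, hF₀.tw']
    · simp [hA, hF₀.tt', hF₀.tw, hF₀.tw', hF₀.wt', hF₀.ww', e3]
    · simp [hA, hF₀.tw', hF₀.t'w', hF₀.ww', e1, e3, e4]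
    · rw [map_sub, map_smul, polarBilin_self, hc₁]
      simp only [smul_eq_mul]
      field_simp
      ring
    · rw [map_sub, map_smul, polarBilin_self, hc₂]
      simp only [smul_eq_mul]
      field_simp
      ring
  have q1 : Q k₁ = 0 := by
    have := hD t k₁ hF.tw
    rw [hk₁] at this
    simpa [ht] using this
  have q2 : Q k₂ = 0 := by
    have := hD t k₂ hF.tw'
    rw [hk₂] at this
    simpa [ht] using this
  have b12 : Q.polarBilin k₁ k₂ = 0 := by
    have := hD t (k₁ + k₂) (by rw [map_add, hF.tw, hF.tw', add_zero])
    rw [quad_add, map_add, hk₁, hk₂, q1, q2] at this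
    simp only [zero_add, add_zero, ne_eq, OfNat.ofNat_ne_zero, not_false_eq_true, zero_pow,
      sub_zero, mul_eq_zero, ht, or_false, false_or] at this
    exact this
  have b1 : Q.polarBilin s k₁ = 0 := by
    have := hD s k₁ (by rw [alt_swap hA, hF.wt', neg_zero])
    rw [q1] at this
    simpa using this
  have b2 : Q.polarBilin s k₂ = 0 := by
    have := hD s k₂ hF.t'w'
    rw [q2] at this
    simpa using this
  -- The pair (t, s) is not isotropic, but (t + k₁, s - k₂) is, and it has the same discriminant
  -- because k₁ and k₂ are in the radical of Q.
  have hts : 4 * Q t * Q s - Q.polarBilin t s ^ 2 = 0 := by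
    have := hD (t + k₁) (s - k₂) (by
      simp [hF.tt', hF.tw', hF.wt', hF.ww'])
    have e1 : Q (t + k₁) = Q t := by rw [quad_add, q1, hk₁]; ring
    have e2 : Q (s - k₂) = Q s := by
      rw [sub_eq_add_neg, ← neg_one_smul ℂ k₂, quad_add, quad_smul, q2, map_smul, b2]; simp
    rw [e1, e2] at this
    have e3 := polarBilin_comm Q s k₁
    rw [b1] at e3
    simpa only [map_add, map_sub, LinearMap.add_apply, hk₂, ← e3, b12, sub_zero, add_zero]
      using this
  obtain ⟨r, hr⟩ := IsAlgClosed.exists_pow_nat_eq (Q t) (n := 2) (by norm_num)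
  have hr0 : r ≠ 0 := by
    rintro rfl
    exact ht (by rw [← hr]; norm_num)
  refine hQ (r • A.flip s + (Q.polarBilin t s / (2 * r)) • A t) fun u => ?_
  obtain ⟨n, hn⟩ := hF.expand hV hA hK u
  set α := A u s
  set β := A t u
  set γ := A u k₂
  set ε := A k₁ u
  have hl : (r • A.flip s + (Q.polarBilin t s / (2 * r)) • A t) u
      = r * α + Q.polarBilin t s / (2 * r) * β := by simp [α, β]
  rw [hl, hn]
  simp only [quad_add, quad_smul, map_add, LinearMap.add_apply, map_smul, LinearMap.smul_apply,
    smul_eq_mul, hQv, hBv, q1, q2, hk₁, hk₂, b12, b1, b2, polarBilin_comm Q k₁ s]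
  field_simp
  rw [← hr] at hts ⊢
  linear_combination (β ^ 2) * hts

theorem eq_zero_of_continuous_of_mul_eq_zero {F : ℂ → ℂ} (hF : Continuous F)
    (h : ∀ s, s * F s = 0) : F 0 = 0 := by
  have : F = fun _ => 0 := by
    refine Continuous.ext_on (dense_compl_singleton (0 : ℂ)) hF continuous_const fun s hs => ?_
    exact (mul_eq_zero.mp (h s)).resolve_left hs
  rw [this]

/-- Half of the Gram determinant of `q` on the plane of bivectors spanned by `a ∧ b`, `v ∧ a` and
`v ∧ b`. -/
noncomputable def gram (q : QuadraticForm ℂ (⋀[ℂ]^2 V)) (v a b : V) : ℂ :=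
  q (wedge a b) * (4 * q (wedge v a) * q (wedge v b)
      - q.polarBilin (wedge v a) (wedge v b) ^ 2)
    - q (wedge v b) * q.polarBilin (wedge a b) (wedge v a) ^ 2
    + q.polarBilin (wedge v a) (wedge v b) * q.polarBilin (wedge a b) (wedge v a)
      * q.polarBilin (wedge a b) (wedge v b)
    - q (wedge v a) * q.polarBilin (wedge a b) (wedge v b) ^ 2

/-- First-order expansion of `gram` at s = 0. The polars with v ∧ a and v ∧ b vanish to first order
and enter squared, so the linear coefficient is the discriminant times the derivative of q along the
curve. The proof divides by s and uses continuity at 0. -/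
theorem polar_eq_zero_of_gram_eq_zero (q : QuadraticForm ℂ (⋀[ℂ]^2 V)) {v a b a' b' : V}
    (hD : 4 * q (wedge v a) * q (wedge v b) - q.polarBilin (wedge v a) (wedge v b) ^ 2 ≠ 0)
    (hq : q (wedge a b) = 0) (h1 : q.polarBilin (wedge a b) (wedge v a) = 0)
    (h2 : q.polarBilin (wedge a b) (wedge v b) = 0)
    (h : ∀ s : ℂ, gram q v (a + s • a') (b + s • b') = 0) :
    q.polarBilin (wedge a b) (wedge a b' + wedge a' b) = 0 := by
  set κ := wedge a b
  set κ₁ := wedge a b' + wedge a' b with hκ₁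
  set κ₂ := wedge a' b'
  set B := q.polarBilin
  have hκ : ∀ s : ℂ, wedge (a + s • a') (b + s • b') = κ + s • (κ₁ + s • κ₂) := by
    intro s
    simp only [wedge_add_left, wedge_add_right, wedge_smul_left, wedge_smul_right, hκ₁, κ, κ₂]
    module
  have hva : ∀ s : ℂ, wedge v (a + s • a') = wedge v a + s • wedge v a' := by
    intro s; rw [wedge_add_right, wedge_smul_right]
  have hvb : ∀ s : ℂ, wedge v (b + s • b') = wedge v b + s • wedge v b' := by
    intro s; rw [wedge_add_right, wedge_smul_right]
  let x : ℂ → ℂ := fun s => B κ κ₁ + s * B κ κ₂ + s * (q κ₁ + s ^ 2 * q κ₂ + s * B κ₁ κ₂)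
  let α : ℂ → ℂ := fun s => q (wedge v a) + s ^ 2 * q (wedge v a') + s * B (wedge v a) (wedge v a')
  let γ : ℂ → ℂ := fun s => q (wedge v b) + s ^ 2 * q (wedge v b') + s * B (wedge v b) (wedge v b')
  let β : ℂ → ℂ := fun s => B (wedge v a) (wedge v b) + s * B (wedge v a) (wedge v b')
    + s * B (wedge v a') (wedge v b) + s ^ 2 * B (wedge v a') (wedge v b')
  let y : ℂ → ℂ := fun s => B κ (wedge v a') + (B κ₁ (wedge v a) + s * B κ₂ (wedge v a))
    + s * (B κ₁ (wedge v a') + s * B κ₂ (wedge v a'))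
  let z : ℂ → ℂ := fun s => B κ (wedge v b') + (B κ₁ (wedge v b) + s * B κ₂ (wedge v b))
    + s * (B κ₁ (wedge v b') + s * B κ₂ (wedge v b'))
  have hF := eq_zero_of_continuous_of_mul_eq_zero
    (F := fun s => x s * (4 * α s * γ s - β s ^ 2) - s * (γ s * y s ^ 2)
      + s * (β s * y s * z s) - s * (α s * z s ^ 2)) (by fun_prop) (fun s => by
    have hs := h s
    have ex : q (κ + s • (κ₁ + s • κ₂)) = s * x s := by
      simp only [quad_add, quad_smul, map_smul, map_add, smul_eq_mul, hq, x, B]; ring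
    have eα : q (wedge v a + s • wedge v a') = α s := by
      simp only [quad_add, quad_smul, map_smul, smul_eq_mul, α, B]
    have eγ : q (wedge v b + s • wedge v b') = γ s := by
      simp only [quad_add, quad_smul, map_smul, smul_eq_mul, γ, B]
    have eβ : B (wedge v a + s • wedge v a') (wedge v b + s • wedge v b') = β s := by
      simp only [map_smul, map_add, smul_eq_mul, LinearMap.add_apply, LinearMap.smul_apply, β]; ring
    have ey : B (κ + s • (κ₁ + s • κ₂)) (wedge v a + s • wedge v a') = s * y s := by
      simp only [map_smul, map_add, smul_eq_mul, LinearMap.add_apply, LinearMap.smul_apply, y, h1]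
      ring
    have ez : B (κ + s • (κ₁ + s • κ₂)) (wedge v b + s • wedge v b') = s * z s := by
      simp only [map_smul, map_add, smul_eq_mul, LinearMap.add_apply, LinearMap.smul_apply, z, h2]
      ring
    rw [gram, hκ, hva, hvb, ex, eα, eγ, eβ, ey, ez] at hs
    linear_combination hs)
  have h0 : B κ κ₁ * (4 * q (wedge v a) * q (wedge v b) - B (wedge v a) (wedge v b) ^ 2) = 0 := by
    simpa [x, α, β, γ] using hF
  exact (mul_eq_zero.mp h0).resolve_right hD

/-- Since v lies in the radical of Q, pairing the relation with a and b gives a linear system whose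
matrix is the invertible Gram matrix. -/
theorem independent_mod_of_discriminant {v a b : V} (Q : QuadraticForm ℂ V)
    (hBv : ∀ u, Q.polarBilin v u = 0)
    (hD : 4 * Q a * Q b - Q.polarBilin a b ^ 2 ≠ 0) (α β : ℂ)
    (h : α • a + β • b ∈ Submodule.span ℂ {v}) : α = 0 ∧ β = 0 := by
  obtain ⟨c, hc⟩ := Submodule.mem_span_singleton.mp h
  have h1 := congrArg (fun x => Q.polarBilin x a) hc
  have h2 := congrArg (fun x => Q.polarBilin x b) hc
  simp only [map_add, map_smul, LinearMap.add_apply, LinearMap.smul_apply, hBv, smul_eq_mul,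
    polarBilin_self, mul_zero, polarBilin_comm Q b a] at h1 h2
  constructor
  · refine (mul_eq_zero.mp (?_ : α * _ = 0)).resolve_right hD
    linear_combination -(2 * Q b) * h1 + (Q.polarBilin a b) * h2
  · refine (mul_eq_zero.mp (?_ : β * _ = 0)).resolve_right hD
    linear_combination (Q.polarBilin a b) * h1 - (2 * Q a) * h2

/-- The quadratic form `u ↦ q (v ∧ u)` on `V`. -/
noncomputable def coneForm (q : QuadraticForm ℂ (⋀[ℂ]^2 V)) (v : V) : QuadraticForm ℂ V :=
  q.comp (wedgeB V v)

theorem coneForm_apply (q : QuadraticForm ℂ (⋀[ℂ]^2 V)) (v u : V) :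
    coneForm q v u = q (wedge v u) := rfl

theorem coneForm_polar (q : QuadraticForm ℂ (⋀[ℂ]^2 V)) (v u w : V) :
    (coneForm q v).polarBilin u w = q.polarBilin (wedge v u) (wedge v w) := by
  simp [QuadraticMap.polar, coneForm_apply, wedge_add_right]

theorem coneForm_self (q : QuadraticForm ℂ (⋀[ℂ]^2 V)) (v : V) : coneForm q v v = 0 := by
  rw [coneForm_apply, wedge_self, QuadraticMap.map_zero]

theorem coneForm_polar_self (q : QuadraticForm ℂ (⋀[ℂ]^2 V)) (v u : V) :
    (coneForm q v).polarBilin v u = 0 := by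
  rw [coneForm_polar, wedge_self, map_zero, LinearMap.zero_apply]

theorem IsSmoothFourfold.exists_discriminant_ne_zero (hV : Module.finrank ℂ V = 5)
    {ω : Module.Dual ℂ (⋀[ℂ]^2 V)} {q : QuadraticForm ℂ (⋀[ℂ]^2 V)} (hX : IsSmoothFourfold ω q)
    {v : V} (hv0 : v ≠ 0) (hv : ∀ u, skew ω v u = 0)
    (hK : ∀ u, (∀ x, skew ω u x = 0) → u ∈ Submodule.span ℂ {v}) :
    ∃ a b, skew ω a b = 0 ∧
      4 * coneForm q v a * coneForm q v b - (coneForm q v).polarBilin a b ^ 2 ≠ 0 :=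
  exists_isotropic_discriminant_ne_zero hV (skew_self ω) hK _ (coneForm_self q v)
    (coneForm_polar_self q v) fun l hl => hX.not_square hV hv0 hv hK l hl

/-- For a general isotropic plane the conic `q = 0` on the bivectors of its preimage is smooth. -/
theorem IsSmoothFourfold.exists_gram_ne_zero (hV : Module.finrank ℂ V = 5)
    {ω : Module.Dual ℂ (⋀[ℂ]^2 V)} {q : QuadraticForm ℂ (⋀[ℂ]^2 V)} (hX : IsSmoothFourfold ω q)
    {v : V} (hv0 : v ≠ 0) (hv : ∀ u, skew ω v u = 0)
    (hK : ∀ u, (∀ x, skew ω u x = 0) → u ∈ Submodule.span ℂ {v}) :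
    ∃ a b, skew ω a b = 0 ∧ gram q v a b ≠ 0 := by
  by_contra! hG
  have hA := skew_self ω
  have hvr : ∀ u, skew ω u v = 0 := fun u => by rw [alt_swap hA, hv, neg_zero]
  obtain ⟨a₀, b₀, hab₀, hD₀⟩ := hX.exists_discriminant_ne_zero hV hv0 hv hK
  rw [coneForm_polar, coneForm_apply, coneForm_apply] at hD₀
  -- Adding multiples of v to a₀ and b₀ changes a₀ ∧ b₀ by combinations of v ∧ a₀ and v ∧ b₀ and
  -- nothing else. As q is nondegenerate on these, Cramer's rule gives the multiples making the
  -- bivector orthogonal to both.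
  obtain ⟨a, b, hab, hD, h1, h2⟩ : ∃ a b, skew ω a b = 0 ∧
      4 * q (wedge v a) * q (wedge v b) - q.polarBilin (wedge v a) (wedge v b) ^ 2 ≠ 0 ∧
      q.polarBilin (wedge a b) (wedge v a) = 0 ∧ q.polarBilin (wedge a b) (wedge v b) = 0 := by
    set b₁ := q.polarBilin (wedge a₀ b₀) (wedge v a₀) with hb₁
    set b₂ := q.polarBilin (wedge a₀ b₀) (wedge v b₀) with hb₂
    set B := q.polarBilin (wedge v a₀) (wedge v b₀) with hB
    set D := 4 * q (wedge v a₀) * q (wedge v b₀) - B ^ 2 with hDdef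
    have e1 : ∀ c : ℂ, wedge v (a₀ + c • v) = wedge v a₀ := fun c => by
      rw [wedge_add_right, wedge_smul_right, wedge_self, smul_zero, add_zero]
    have e2 : ∀ c : ℂ, wedge v (b₀ + c • v) = wedge v b₀ := fun c => by
      rw [wedge_add_right, wedge_smul_right, wedge_self, smul_zero, add_zero]
    have e3 : ∀ c d : ℂ, wedge (a₀ + c • v) (b₀ + d • v)
        = wedge a₀ b₀ + c • wedge v b₀ - d • wedge v a₀ := fun c d => by
      rw [wedge_add_right, wedge_add_left, wedge_add_left, wedge_smul_right, wedge_smul_right,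
        wedge_smul_left, wedge_smul_left, wedge_self, wedge_swap v a₀]
      module
    refine ⟨a₀ + ((B * b₁ - 2 * q (wedge v a₀) * b₂) / D) • v,
      b₀ + ((2 * q (wedge v b₀) * b₁ - B * b₂) / D) • v, ?_, ?_, ?_, ?_⟩
    · simp [hab₀, hv, hvr]
    · rw [e1, e2]; exact hD₀
    · rw [e1, e3]
      simp only [map_add, map_sub, map_smul, LinearMap.add_apply, LinearMap.sub_apply,
        LinearMap.smul_apply, smul_eq_mul, polarBilin_self, ← hb₁,
        polarBilin_comm q (wedge v b₀) (wedge v a₀), ← hB]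
      field_simp
      rw [hDdef]; ring
    · rw [e2, e3]
      simp only [map_add, map_sub, map_smul, LinearMap.add_apply, LinearMap.sub_apply,
        LinearMap.smul_apply, smul_eq_mul, polarBilin_self, ← hb₂, ← hB]
      field_simp
      rw [hDdef]; ring
  have hind := independent_mod_of_discriminant (v := v) (a := a) (b := b) (coneForm q v)
    (coneForm_polar_self q v) (by
      rwa [coneForm_polar, coneForm_apply, coneForm_apply])
  have hlin : LinearIndependent ℂ ![a, b] := LinearIndependent.pair_iff.mpr fun x y h =>
    hind x y (by rw [h]; exact Submodule.zero_mem _)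
  -- By orthogonality `gram` reduces to q(a ∧ b) times the discriminant; so the vertex a ∧ b of the
  -- singular conic lies on X.
  have hq : q (wedge a b) = 0 := by
    have := hG a b hab
    rw [gram, h1, h2] at this
    refine (mul_eq_zero.mp ?_).resolve_right hD
    linear_combination this
  obtain ⟨a', b', hF⟩ := exists_frame hA hK hab hind
  have e3 := alt_swap hA a b
  rw [hab] at e3
  have key : ∀ x y : V, (∀ s : ℂ, skew ω (a + s • x) (b + s • y) = 0) →
      q.polarBilin (wedge a b) (wedge a y + wedge x b) = 0 := fun x y hxy =>
    polar_eq_zero_of_gram_eq_zero q hD hq h1 h2 fun s => hG _ _ (hxy s)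
  obtain ⟨y, z, hyz, hne⟩ := hX.exists_tangent hV hlin hab hq
  apply hne
  set θ := skew ω a y with hθ
  have hθ' : skew ω b z = -θ := by
    rw [map_add, ← skew_apply, ← skew_apply, ← hθ] at hyz
    linear_combination hyz
  -- Three deformations of (a, b) along straight lines that stay isotropic for every s. Their
  -- derivatives combine to the given tangent vector, contradicting smoothness at a ∧ b.
  have k1 := key 0 (y - θ • a') (fun s => by
    simp [hab, ← hθ, hF.tt'])
  have k2 := key (z + θ • b') 0 (fun s => by
    simp [hab, alt_swap hA b z, hθ', alt_swap hA b b', hF.ww'])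
  have k3 := key b' a' (fun s => by
    simp [hab, hF.tt', alt_swap hA b b', hF.ww', alt_swap hA a' b', hF.t'w'])
  have : wedge a y + wedge b z = (wedge a (y - θ • a') + wedge 0 b)
      - (wedge a 0 + wedge (z + θ • b') b) + θ • (wedge a a' + wedge b' b) := by
    simp only [wedge_sub_right, wedge_add_left, wedge_smul_left, wedge_smul_right,
      wedge_zero_left, wedge_zero_right, wedge_swap b z]
    module
  rw [this, map_add, map_sub, map_smul, k1, k2, k3]
  simp

end Discriminant

/-! ### A Nullstellensatz for quadrics. -/

section QuadricNullstellensatz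

variable {W : Type*} [AddCommGroup W] [Module ℂ W]

/-- Restricted to the line through x₀ and x, both forms become polynomials in one variable, and ℂ[X]
is a domain. -/
theorem forall_eq_zero_of_mul_eq_zero (P D : QuadraticForm ℂ W) (h : ∀ x, P x * D x = 0) {x₀ : W}
    (hx₀ : D x₀ ≠ 0) (x : W) : P x = 0 := by
  open Polynomial in
  have line : ∀ (R : QuadraticForm ℂ W) (s : ℂ), R (x₀ + s • (x - x₀))
      = (C (R x₀) + C (R.polarBilin x₀ (x - x₀)) * X + C (R (x - x₀)) * X ^ 2 :
        Polynomial ℂ).eval s := by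
    intro R s
    rw [quad_add, quad_smul, map_smul]
    simp
    ring
  open Polynomial in
  have hmul : (C (P x₀) + C (P.polarBilin x₀ (x - x₀)) * X + C (P (x - x₀)) * X ^ 2 :
        Polynomial ℂ) * (C (D x₀) + C (D.polarBilin x₀ (x - x₀)) * X + C (D (x - x₀)) * X ^ 2 :
        Polynomial ℂ) = 0 := by
    refine Polynomial.funext fun s => ?_
    rw [Polynomial.eval_mul, ← line, ← line, h, Polynomial.eval_zero]
  rcases mul_eq_zero.mp hmul with h0 | h0
  · have := line P 1
    rw [h0] at this
    simpa using this
  · have := line D 0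
    rw [h0] at this
    simp [hx₀] at this

/-- If l x = 0, then l is a nonzero constant along e + t x, so r has no zero there. A polynomial in
t without roots is constant, hence x is in the kernel of r and orthogonal to e. -/
theorem eq_const_mul_sq_of_zero_le (r : QuadraticForm ℂ W) (l : Module.Dual ℂ W)
    (hl : ∃ e, l e ≠ 0) (h : ∀ x, r x = 0 → l x = 0) : ∃ c : ℂ, ∀ x, r x = c * l x ^ 2 := by
  obtain ⟨e, he⟩ := hl
  have hk : ∀ x, l x = 0 → r x = 0 ∧ r.polarBilin e x = 0 := by
    intro x hx
    have hno : ∀ t : ℂ, r e + t ^ 2 * r x + t * r.polarBilin e x ≠ 0 := by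
      intro t ht
      have := h (e + t • x) (by rw [quad_add, quad_smul, map_smul, smul_eq_mul]; exact ht)
      rw [map_add, map_smul, hx, smul_zero, add_zero] at this
      exact he this
    have h1 : r x = 0 := by
      by_contra h1
      obtain ⟨t, ht⟩ := exists_quadratic_root h1 (r.polarBilin e x) (r e)
      exact hno t (by linear_combination ht)
    refine ⟨h1, ?_⟩
    by_contra h2
    refine hno (-(r e) / r.polarBilin e x) ?_
    rw [h1]
    field_simp
    ring
  refine ⟨r e / l e ^ 2, fun x => ?_⟩
  obtain ⟨h1, h2⟩ := hk (x - (l x / l e) • e) (by simp [he])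
  have : x = (l x / l e) • e + (x - (l x / l e) • e) := by abel
  rw [this, quad_add, quad_smul, h1, map_smul, LinearMap.smul_apply, h2, ← this]
  simp only [smul_eq_mul]
  field_simp
  ring

/-- A quadratic form vanishing on the zeros of a quadratic form `r` which is not a product of
linear forms is proportional to `r`. -/
theorem eq_const_mul_of_zero_le (r q : QuadraticForm ℂ W)
    (hr : ¬ ∃ l m : Module.Dual ℂ W, ∀ x, r x = l x * m x)
    (h : ∀ x, r x = 0 → q x = 0) : ∃ c : ℂ, ∀ x, q x = c * r x := by
  obtain ⟨e, he⟩ : ∃ e, r e ≠ 0 := by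
    by_contra! h0
    exact hr ⟨0, 0, fun x => by simp [h0]⟩
  let D : QuadraticForm ℂ W := QuadraticMap.linMulLin (r.polarBilin e) (r.polarBilin e)
    - (4 * r e) • r
  have hDx : ∀ x, D x = r.polarBilin e x ^ 2 - 4 * r e * r x := fun x => by
    simp [D]; ring
  -- D is the discriminant of r on the lines of direction e; were it zero, r would be a multiple of
  -- the square of its polar at e.
  obtain ⟨x₀, hx₀⟩ : ∃ x₀, D x₀ ≠ 0 := by
    by_contra! h0
    refine hr ⟨(4 * r e)⁻¹ • r.polarBilin e, r.polarBilin e, fun x => ?_⟩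
    have := h0 x
    rw [hDx] at this
    rw [LinearMap.smul_apply, smul_eq_mul]
    field_simp
    linear_combination -this
  refine ⟨q e / r e, fun x => ?_⟩
  have hP := forall_eq_zero_of_mul_eq_zero (r e • q - q e • r) D (fun x => ?_) hx₀ x
  · simp only [sub_apply, smul_apply, smul_eq_mul] at hP
    field_simp
    linear_combination hP
  · by_cases hD0 : D x = 0
    · rw [hD0, mul_zero]
    refine mul_eq_zero_of_left ?_ _
    obtain ⟨s, hs⟩ := IsAlgClosed.exists_pow_nat_eq (D x) (n := 2) (by norm_num)
    have hs0 : s ≠ 0 := by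
      rintro rfl
      exact hD0 (by rw [← hs]; norm_num)
    rw [hDx] at hs
    set b := r.polarBilin e x with hb
    -- Both roots of r on x + t e are roots of q. When D x ≠ 0 they are distinct, so the two
    -- quadratics in t are proportional.
    have root : ∀ ε : ℂ, ε ^ 2 = 1 → q x + ((-b + ε * s) / (2 * r e)) ^ 2 * q e
        + ((-b + ε * s) / (2 * r e)) * q.polarBilin x e = 0 := by
      intro ε hε
      have := h (x + ((-b + ε * s) / (2 * r e)) • e) (by
        rw [quad_add, quad_smul, map_smul, smul_eq_mul, polarBilin_comm r x e, ← hb]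
        field_simp
        linear_combination s ^ 2 * hε + hs)
      rwa [quad_add, quad_smul, map_smul, smul_eq_mul] at this
    have h1 := root 1 (by norm_num)
    have h2 := root (-1) (by norm_num)
    simp only [sub_apply, smul_apply, smul_eq_mul]
    field_simp at h1 h2
    have h3 : q.polarBilin x e * r e = q e * b := by
      have : s * (q.polarBilin x e * r e - q e * b) = 0 := by
        linear_combination (1 / 4) * (h1 - h2)
      exact sub_eq_zero.mp ((mul_eq_zero.mp this).resolve_left hs0)
    have h4 : (r e * q x - q e * r x) * (4 * r e) = 0 := by
      linear_combination (1 / 2) * (h1 + h2) - q e * hs + 2 * b * h3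
    exact (mul_eq_zero.mp h4).resolve_right (by simp [he])

end QuadricNullstellensatz

/-! ### Uniqueness of the irreducible σ-quadric. -/

section Sigma

variable {V : Type*} [AddCommGroup V] [Module ℂ V]

theorem star_eq_range (v : V) : star v = LinearMap.range (wedgeB V v) := by
  have : Set.range (wedge v) = (LinearMap.range (wedgeB V v) : Set (⋀[ℂ]^2 V)) := by
    ext; simp [wedgeB_apply]
  rw [star, this, Submodule.span_eq]

theorem mem_star {v : V} {η : ⋀[ℂ]^2 V} : η ∈ star v ↔ ∃ u, wedge v u = η := by
  rw [star_eq_range]; rfl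

theorem sigmaQuadric_subset_fourfold {ω : Module.Dual ℂ (⋀[ℂ]^2 V)}
    (q : QuadraticForm ℂ (⋀[ℂ]^2 V)) {v : V} (hv : ∀ u, skew ω v u = 0) :
    sigmaQuadric v q ⊆ fourfold ω q := by
  rintro x ⟨hx, hq⟩
  obtain ⟨u, hu⟩ := mem_star.mp hx
  exact ⟨⟨v, u, hu.symm⟩, by rw [← hu]; exact hv u, hq⟩

theorem mk_mem_sigmaQuadric {q : QuadraticForm ℂ (⋀[ℂ]^2 V)} {v : V} {η : ⋀[ℂ]^2 V} (h0 : η ≠ 0)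
    (hη : η ∈ star v) (hq : q η = 0) : Projectivization.mk ℂ η h0 ∈ sigmaQuadric v q := by
  obtain ⟨c, -, hc⟩ := exists_rep_mk η h0
  exact ⟨by rw [hc]; exact Submodule.smul_mem _ _ hη, by rw [hc, quad_smul, hq, mul_zero]⟩

/-- The irreducible `σ`-quadrics of the fourfold lie over the kernel of the skew form. -/
theorem eq_sigmaQuadric {ω : Module.Dual ℂ (⋀[ℂ]^2 V)} {q : QuadraticForm ℂ (⋀[ℂ]^2 V)} {v : V}
    (hK : ∀ u, (∀ x, skew ω u x = 0) → u ∈ Submodule.span ℂ {v})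
    (hq : ∃ η ∈ star v, q η ≠ 0) {S : Set (ℙ ℂ (⋀[ℂ]^2 V))} (hS : IsIrreducibleSigmaQuadric S)
    (hSX : S ⊆ fourfold ω q) : S = sigmaQuadric v q := by
  obtain ⟨v', r, hv', hr, rfl⟩ := hS
  have hzero : ∀ η ∈ star v', r η = 0 → ω η = 0 ∧ q η = 0 := by
    intro η hη hrη
    by_cases h0 : η = 0
    · subst h0; simp
    obtain ⟨-, h1, h2⟩ := hSX (mk_mem_sigmaQuadric h0 hη hrη)
    obtain ⟨c, hc0, hc⟩ := exists_rep_mk η h0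
    rw [hc] at h1 h2
    rw [map_smul, smul_eq_mul] at h1
    rw [quad_smul] at h2
    exact ⟨(mul_eq_zero.mp h1).resolve_left hc0,
      (mul_eq_zero.mp h2).resolve_left (pow_ne_zero 2 hc0)⟩
  have hprod : ¬ ∃ l m : Module.Dual ℂ (star v'), ∀ x, r.comp (star v').subtype x = l x * m x := by
    rintro ⟨l, m, hlm⟩
    obtain ⟨l', hl'⟩ := LinearMap.exists_extend l
    obtain ⟨m', hm'⟩ := LinearMap.exists_extend m
    refine hr ⟨l', m', fun η hη => ?_⟩
    have h1 := hlm ⟨η, hη⟩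
    rw [← hl', ← hm'] at h1
    exact h1
  -- A nonzero ω vanishing on the zeros of r would make r a multiple of ω², a product of linear
  -- forms.
  have hω : ∀ η ∈ star v', ω η = 0 := by
    by_contra! hne
    obtain ⟨η, hη, hωη⟩ := hne
    obtain ⟨c, hc⟩ := eq_const_mul_sq_of_zero_le (W := star v')
      (r.comp (star v').subtype : QuadraticForm ℂ (star v'))
      (ω.comp (star v').subtype) ⟨(⟨η, hη⟩ : star v'), hωη⟩
      (fun (x : star v') hx => (hzero _ x.2 hx).1)
    exact hprod ⟨c • ω.comp (star v').subtype, ω.comp (star v').subtype, fun x => by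
      rw [hc, LinearMap.smul_apply, smul_eq_mul]; ring⟩
  obtain ⟨c, rfl⟩ := Submodule.mem_span_singleton.mp
    (hK v' fun x => hω _ (mem_star.mpr ⟨x, rfl⟩))
  have hc0 : c ≠ 0 := by
    rintro rfl
    exact hv' (zero_smul _ _)
  have hstar : star (c • v) = star v := by
    ext η
    rw [mem_star, mem_star]
    constructor
    · rintro ⟨u, rfl⟩
      exact ⟨c • u, by rw [wedge_smul_left, wedge_smul_right]⟩
    · rintro ⟨u, rfl⟩
      exact ⟨c⁻¹ • u, by rw [wedge_smul_left, wedge_smul_right, smul_smul, mul_inv_cancel₀ hc0,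
        one_smul]⟩
  obtain ⟨k, hk⟩ := eq_const_mul_of_zero_le (W := star (c • v))
    (r.comp (star (c • v)).subtype : QuadraticForm ℂ (star (c • v)))
    (q.comp (star (c • v)).subtype : QuadraticForm ℂ (star (c • v))) hprod
    (fun (x : star (c • v)) hx => (hzero _ x.2 hx).2)
  have hk' : ∀ η ∈ star v, q η = k * r η := fun η hη => hk ⟨η, by rwa [hstar]⟩
  have hk0 : k ≠ 0 := by
    rintro rfl
    obtain ⟨η, hη, hqη⟩ := hq
    exact hqη (by rw [hk' η hη, zero_mul])
  ext x
  simp only [sigmaQuadric, hstar, Set.mem_ofPred_eq]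
  refine and_congr_right fun hx => ?_
  rw [hk' _ hx]
  simp [hk0]

end Sigma

/-! ### Planes, their bivectors, and the zeros of a quadratic form on a plane. -/

section Bivectors

variable {V : Type*} [AddCommGroup V] [Module ℂ V]

/-- If `u ∧ s` is a nonzero multiple of `a ∧ b ≠ 0`, then `u` lies in the plane of `a` and `b`. -/
theorem mem_plane_of_wedge_eq {a b u s : V} {k : ℂ} (hk : k ≠ 0) (hab : wedge a b ≠ 0)
    (h : wedge u s = k • wedge a b) : ∃ α β : ℂ, u = α • a + β • b := by
  by_contra! hcon
  have hu : u ∉ Submodule.span ℂ {a, b} := fun hmem => by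
    obtain ⟨α, β, h⟩ := Submodule.mem_span_pair.mp hmem
    exact hcon α β h.symm
  obtain ⟨f, hf, hfab⟩ := Submodule.exists_dual_map_eq_bot_of_notMem hu inferInstance
  have hzero : ∀ x ∈ Submodule.span ℂ {a, b}, f x = 0 := by
    intro x hx
    have : f x ∈ (Submodule.span ℂ {a, b}).map f := Submodule.mem_map_of_mem hx
    rwa [hfab, Submodule.mem_bot] at this
  have hfa := hzero a (Submodule.subset_span (by simp))
  have hfb := hzero b (Submodule.subset_span (by simp))
  have h1 := congrArg (contract V f) h
  rw [map_smul, contract_wedge, contract_wedge, hfa, hfb] at h1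
  simp only [zero_smul, sub_zero, smul_zero] at h1
  have hs : s = (f s / f u) • u := by
    rw [sub_eq_zero] at h1
    rw [div_eq_inv_mul, mul_smul, ← h1, smul_smul, inv_mul_cancel₀ hf, one_smul]
  rw [hs, wedge_smul_right, wedge_self, smul_zero] at h
  exact hab ((smul_eq_zero.mp h.symm).resolve_left hk)

theorem exists_wedge_eq_of_ne_zero {a b : V} {α β : ℂ} (h : α • a + β • b ≠ 0) :
    ∃ t, wedge (α • a + β • b) t = wedge a b := by
  by_cases hα : α = 0
  · subst hα
    have hβ : β ≠ 0 := by
      rintro rfl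
      simp at h
    refine ⟨-(β⁻¹ • a), ?_⟩
    rw [zero_smul, zero_add, wedge_neg_right, wedge_smul_left, wedge_smul_right, smul_smul,
      mul_inv_cancel₀ hβ, one_smul, wedge_swap a b, neg_neg]
  · refine ⟨α⁻¹ • b, ?_⟩
    rw [wedge_add_left, wedge_smul_left, wedge_smul_left, wedge_smul_right, wedge_smul_right,
      wedge_self, smul_zero, smul_zero, add_zero, smul_smul, mul_inv_cancel₀ hα, one_smul]

/-- If `Q` does not vanish at the zero of `g` on the plane of `a` and `b`, then `g` does not vanish
at the zeros of `Q`. -/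
theorem apply_ne_zero_of_contract {Q : QuadraticForm ℂ V} {g : Module.Dual ℂ V} {a b : V}
    (h : Q (contract V g (wedge a b)) ≠ 0) {α β : ℂ} (hr : α • a + β • b ≠ 0)
    (hQ : Q (α • a + β • b) = 0) : g (α • a + β • b) ≠ 0 := by
  -- Write r for the zero of Q. If g r = 0, contracting r ∧ t with g gives a multiple of r, where Q
  -- vanishes.
  obtain ⟨t, ht⟩ := exists_wedge_eq_of_ne_zero hr
  intro hg
  rw [← ht, contract_wedge, hg, zero_smul, zero_sub, ← neg_smul, quad_smul, hQ, mul_zero] at h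
  exact h rfl

/-- The two roots of a quadratic form on a plane on which it is nondegenerate. -/
theorem exists_roots {Q : QuadraticForm ℂ V} {a b : V}
    (hD : 4 * Q a * Q b - Q.polarBilin a b ^ 2 ≠ 0) :
    ∃ (r₁ r₂ : V) (k : ℂ), Q r₁ = 0 ∧ Q r₂ = 0 ∧ Q.polarBilin r₁ r₂ ≠ 0 ∧ k ≠ 0 ∧
      wedge a b = k • wedge r₁ r₂ := by
  by_cases hb : Q b = 0
  · have hB : Q.polarBilin a b ≠ 0 := by
      intro h0
      rw [hb, h0] at hD
      simp at hD
    refine ⟨b, a + (-(Q a / Q.polarBilin a b)) • b, -1, hb, ?_, ?_, by norm_num, ?_⟩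
    · rw [quad_add, quad_smul, hb, map_smul, smul_eq_mul]
      field_simp
      ring
    · rw [map_add, map_smul, polarBilin_self, hb, polarBilin_comm Q b a]
      simpa using hB
    · rw [wedge_add_right, wedge_smul_right, wedge_self, smul_zero, add_zero, wedge_swap a b]
      simp
  · obtain ⟨s, hs⟩ := IsAlgClosed.exists_pow_nat_eq (Q.polarBilin a b ^ 2 - 4 * Q a * Q b) (n := 2)
      (by norm_num)
    have hs0 : s ≠ 0 := by
      rintro rfl
      apply hD
      linear_combination hs
    set B := Q.polarBilin a b with hB
    have root : ∀ ε : ℂ, ε ^ 2 = 1 → Q (a + ((-B + ε * s) / (2 * Q b)) • b) = 0 := by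
      intro ε hε
      rw [quad_add, quad_smul, map_smul, smul_eq_mul, ← hB]
      field_simp
      linear_combination s ^ 2 * hε + hs
    have h2 : ((-B + (-1) * s) / (2 * Q b)) - ((-B + 1 * s) / (2 * Q b)) = -s / Q b := by
      field_simp
      ring
    refine ⟨_, _, -(Q b / s), root 1 (by norm_num), root (-1) (by norm_num), ?_,
      by simp [hb, hs0], ?_⟩
    · simp only [map_add, map_smul, LinearMap.add_apply, LinearMap.smul_apply, smul_eq_mul,
        polarBilin_self, polarBilin_comm Q b a, ← hB]
      intro h0
      apply hD
      field_simp at h0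
      linear_combination (1 / 2) * h0 + (1 / 2) * hs
    · rw [wedge_add_left, wedge_add_right, wedge_add_right, wedge_self, wedge_smul_right,
        wedge_smul_left, wedge_smul_left, wedge_smul_right, wedge_self, wedge_swap a b]
      have : (-(Q b / s)) * (((-B + (-1) * s) / (2 * Q b)) - ((-B + 1 * s) / (2 * Q b))) = 1 := by
        rw [h2]; field_simp
      calc wedge a b = ((-(Q b / s)) * (((-B + (-1) * s) / (2 * Q b))
            - ((-B + 1 * s) / (2 * Q b)))) • wedge a b := by rw [this, one_smul]
        _ = _ := by module

end Bivectors

/-! ### The residual-intersection map in symplectic coordinates. -/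

section Cover

variable {V : Type*} [AddCommGroup V] [Module ℂ V]

/-- Symplectic coordinates `x₀, …, x₃` on `V / ⟨v⟩`, dual to vectors `c₀, …, c₃` with
`ω(c₀, c₃) = ω(c₁, c₂) = 1`. -/
structure Chart (ω : Module.Dual ℂ (⋀[ℂ]^2 V)) (v : V) where
  (c₀ c₁ c₂ c₃ : V)
  (x₀ x₁ x₂ : Module.Dual ℂ V)
  x₀v : x₀ v = 0
  x₁v : x₁ v = 0
  x₂v : x₂ v = 0
  x₀c₁ : x₀ c₁ = 0
  x₀c₂ : x₀ c₂ = 0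
  x₀c₃ : x₀ c₃ = 0
  x₁c₁ : x₁ c₁ = 1
  x₁c₂ : x₁ c₂ = 0
  x₁c₃ : x₁ c₃ = 0
  x₂c₁ : x₂ c₁ = 0
  x₂c₂ : x₂ c₂ = 1
  x₂c₃ : x₂ c₃ = 0
  skew_v : ∀ u, skew ω u v = 0
  skew_c₁ : ∀ u, skew ω u c₁ = -x₂ u
  skew_c₂ : ∀ u, skew ω u c₂ = x₁ u
  skew_c₃ : ∀ u, skew ω u c₃ = x₀ u
  expand : ∀ u, ∃ s r : ℂ, u = s • v + x₀ u • c₀ + x₁ u • c₁ + x₂ u • c₂ + r • c₃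

namespace Chart

variable {ω : Module.Dual ℂ (⋀[ℂ]^2 V)} {v : V} (K : Chart ω v)

/-- The vector of `⟨c₁, c₂, c₃⟩` orthogonal to `u` with parameters `m₁, m₂`. -/
def transversal (u : V) (m₁ m₂ : ℂ) : V :=
  K.x₀ u • (m₁ • K.c₁ + m₂ • K.c₂) - (K.x₁ u * m₂ - K.x₂ u * m₁) • K.c₃

theorem skew_transversal (u : V) (m₁ m₂ : ℂ) : skew ω u (K.transversal u m₁ m₂) = 0 := by
  simp only [transversal, map_sub, map_add, map_smul, smul_eq_mul, K.skew_c₁, K.skew_c₂, K.skew_c₃]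
  ring

/-- The vector x₀(u) t - x₀(t) u has no c₀-component, and orthogonality to u then determines its
c₃-component after multiplication by x₀(u). So the transversal vectors represent u^⊥/⟨u, v⟩ wherever
x₀(u) ≠ 0. -/
theorem exists_transversal_eq {u t : V} (h : skew ω u t = 0) :
    ∃ n : ℂ, K.x₀ u • (K.x₀ u • t - K.x₀ t • u)
      = K.transversal u (K.x₀ u * K.x₁ t - K.x₀ t * K.x₁ u)
          (K.x₀ u * K.x₂ t - K.x₀ t * K.x₂ u) + n • v := by
  obtain ⟨s, r, hd⟩ := K.expand (K.x₀ u • t - K.x₀ t • u)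
  have h1 := congrArg (skew ω u) hd
  simp only [map_sub, map_add, map_smul, smul_eq_mul, K.skew_c₁, K.skew_c₂, K.skew_c₃, K.skew_v,
    h, skew_self] at h1
  simp only [map_sub, map_smul, smul_eq_mul] at hd
  have h0 : K.x₀ u * K.x₀ t - K.x₀ t * K.x₀ u = 0 := by ring
  rw [h0] at h1 hd
  have hr : K.x₀ u * r = -(K.x₁ u * (K.x₀ u * K.x₂ t - K.x₀ t * K.x₂ u)
      - K.x₂ u * (K.x₀ u * K.x₁ t - K.x₀ t * K.x₁ u)) := by
    linear_combination -h1
  refine ⟨K.x₀ u * s, ?_⟩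
  rw [hd, transversal]
  simp only [smul_add, smul_smul, hr]
  module

theorem transversal_smul (u : V) (m m₁ m₂ : ℂ) :
    K.transversal u (m * m₁) (m * m₂) = m • K.transversal u m₁ m₂ := by
  simp only [transversal]
  module

/-- The residual point of the line joining `v ∧ u` to `u ∧ w`, `w` the transversal vector, with
the quadric. -/
noncomputable def cover (q : QuadraticForm ℂ (⋀[ℂ]^2 V)) (u : V) (m₁ m₂ : ℂ) : ⋀[ℂ]^2 V :=
  q (wedge u (K.transversal u m₁ m₂)) • wedge v u
    - q.polarBilin (wedge v u) (wedge u (K.transversal u m₁ m₂))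
      • wedge u (K.transversal u m₁ m₂)

variable (q : QuadraticForm ℂ (⋀[ℂ]^2 V))

theorem cover_eq_wedge (u : V) (m₁ m₂ : ℂ) : ∃ s, K.cover q u m₁ m₂ = wedge u s := by
  refine ⟨-(q (wedge u (K.transversal u m₁ m₂)) • v)
    - q.polarBilin (wedge v u) (wedge u (K.transversal u m₁ m₂)) • K.transversal u m₁ m₂, ?_⟩
  rw [cover, wedge_sub_right, wedge_neg_right, wedge_smul_right, wedge_smul_right, wedge_swap v u]
  module

theorem apply_cover (u : V) (m₁ m₂ : ℂ) : ω (K.cover q u m₁ m₂) = 0 := by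
  have h1 := K.skew_transversal u m₁ m₂
  have h2 := K.skew_v u
  rw [skew_apply] at h1 h2
  rw [cover, map_sub, map_smul, map_smul, h1, wedge_swap u v, map_neg, h2]
  simp

/-- With p = v ∧ u and ξ = u ∧ w one has q(αp + βξ) = β(αB(p, ξ) + βq(ξ)); the cover takes α = q(ξ),
β = -B(p, ξ). -/
theorem quad_cover {u : V} (hu : q (wedge v u) = 0) (m₁ m₂ : ℂ) : q (K.cover q u m₁ m₂) = 0 := by
  have h : ∀ (c d : ℂ) (x y : ⋀[ℂ]^2 V), c • x - d • y = c • x + (-d) • y := fun c d x y => by module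
  rw [cover, h, quad_add, quad_smul, quad_smul, hu, map_smul, map_smul,
    LinearMap.smul_apply, smul_eq_mul, smul_eq_mul]
  ring

theorem polar_cover {u : V} (hu : q (wedge v u) = 0) (m₁ m₂ : ℂ) :
    q.polarBilin (wedge v u) (K.cover q u m₁ m₂)
      = -q.polarBilin (wedge v u) (wedge u (K.transversal u m₁ m₂)) ^ 2 := by
  rw [cover, map_sub, map_smul, map_smul, polarBilin_self, hu, smul_eq_mul, smul_eq_mul]
  ring

/-- The composite of the contractions is the Plücker coordinate x₀ ∧ x₁. It kills v ∧ u and sees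
only m₁ on the transversal; with its companion for x₂ it recovers the ratio m₁ : m₂ from the image.
-/
theorem x₁_contract_cover (u : V) (m₁ m₂ : ℂ) :
    K.x₁ (contract V K.x₀ (K.cover q u m₁ m₂))
      = -(q.polarBilin (wedge v u) (wedge u (K.transversal u m₁ m₂)) * K.x₀ u ^ 2) * m₁ := by
  simp only [cover, map_sub, map_smul, contract_wedge, smul_eq_mul, K.x₀v, K.x₁v]
  simp only [transversal, map_sub, map_add, map_smul, smul_eq_mul, K.x₀c₁, K.x₀c₂, K.x₀c₃, K.x₁c₁,
    K.x₁c₂, K.x₁c₃]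
  ring

theorem x₂_contract_cover (u : V) (m₁ m₂ : ℂ) :
    K.x₂ (contract V K.x₀ (K.cover q u m₁ m₂))
      = -(q.polarBilin (wedge v u) (wedge u (K.transversal u m₁ m₂)) * K.x₀ u ^ 2) * m₂ := by
  simp only [cover, map_sub, map_smul, contract_wedge, smul_eq_mul, K.x₀v, K.x₂v]
  simp only [transversal, map_sub, map_add, map_smul, smul_eq_mul, K.x₀c₁, K.x₀c₂, K.x₀c₃, K.x₂c₁,
    K.x₂c₂, K.x₂c₃]
  ring

/-- With these parameters u ∧ w is a combination of u ∧ t and v ∧ u, so it spans with v ∧ u the same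
line, whose residual point is u ∧ t. The factor m reflects that only the ratio of the parameters
matters. -/
theorem cover_eq_smul {u t : V} (hω : ω (wedge u t) = 0) (hq : q (wedge u t) = 0)
    (hu : q (wedge v u) = 0) (hx : K.x₀ u ≠ 0) (hb : q.polarBilin (wedge v u) (wedge u t) ≠ 0)
    {m : ℂ} (hm : m ≠ 0) :
    ∃ k : ℂ, k ≠ 0 ∧ K.cover q u (m * K.x₁ (contract V K.x₀ (wedge u t)))
      (m * K.x₂ (contract V K.x₀ (wedge u t))) = k • wedge u t := by
  obtain ⟨n, hn⟩ := K.exists_transversal_eq (u := u) (t := t) hω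
  have h1 : K.x₁ (contract V K.x₀ (wedge u t)) = K.x₀ u * K.x₁ t - K.x₀ t * K.x₁ u := by
    simp
  have h2 : K.x₂ (contract V K.x₀ (wedge u t)) = K.x₀ u * K.x₂ t - K.x₀ t * K.x₂ u := by
    simp
  have hw : wedge u (K.transversal u (m * K.x₁ (contract V K.x₀ (wedge u t)))
      (m * K.x₂ (contract V K.x₀ (wedge u t))))
      = (m * K.x₀ u ^ 2) • wedge u t + (m * n) • wedge v u := by
    rw [transversal_smul, h1, h2, eq_sub_of_add_eq hn.symm]
    simp only [wedge_smul_right, wedge_sub_right, wedge_self, wedge_swap v u]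
    module
  refine ⟨-(m * K.x₀ u ^ 2) ^ 2 * q.polarBilin (wedge v u) (wedge u t),
    mul_ne_zero (neg_ne_zero.mpr (pow_ne_zero 2 (mul_ne_zero hm (pow_ne_zero 2 hx)))) hb, ?_⟩
  rw [cover, hw, quad_add, quad_smul, quad_smul, hq, hu, map_add, map_smul, map_smul, map_smul,
    map_smul, LinearMap.smul_apply, polarBilin_self, hu, polarBilin_comm q (wedge u t)]
  simp only [smul_eq_mul]
  module

theorem isHomogeneousMap_cover [Module.Finite ℂ V] {E : Type*} [AddCommGroup E] [Module ℂ E]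
    {d e : ℕ} {û : E → V} {μ₁ μ₂ : E → ℂ} (hu : IsHomogeneousMap d û)
    (h₁ : IsHomogeneousMap e μ₁) (h₂ : IsHomogeneousMap e μ₂) :
    ∃ n, IsHomogeneousMap n (fun y => K.cover q (û y) (μ₁ y) (μ₂ y)) := by
  have hw : IsHomogeneousMap (d + e) (fun y => K.transversal (û y) (μ₁ y) (μ₂ y)) := by
    refine IsHomogeneousMap.sub ?_ ?_
    · refine IsHomogeneousMap.smul (hu.linear_comp K.x₀) (IsHomogeneousMap.add ?_ ?_)
      · exact h₁.linear_comp (LinearMap.toSpanSingleton ℂ V K.c₁)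
      · exact h₂.linear_comp (LinearMap.toSpanSingleton ℂ V K.c₂)
    · refine IsHomogeneousMap.linear_comp (A := LinearMap.toSpanSingleton ℂ V K.c₃)
        (G := fun y => K.x₁ (û y) * μ₂ y - K.x₂ (û y) * μ₁ y) ?_
      exact ((hu.linear_comp K.x₁).smul h₂).sub ((hu.linear_comp K.x₂).smul h₁)
  have hξ : IsHomogeneousMap (d + (d + e))
      (fun y => wedge (û y) (K.transversal (û y) (μ₁ y) (μ₂ y))) :=
    IsHomogeneousMap.bilinear (wedgeB V) hu hw
  have hp : IsHomogeneousMap d (fun y => wedge v (û y)) := hu.linear_comp (wedgeB V v)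
  have ha := (hξ.quadratic q).smul hp
  have hb := (IsHomogeneousMap.bilinear q.polarBilin hp hξ).smul hξ
  refine ⟨_, ha.sub ?_⟩
  convert hb using 1
  ring

end Chart

end Cover

/-! ### Counting the points of a fibre with vectors. -/

section Fiber

variable {E F : Type*} [AddCommGroup E] [Module ℂ E] [AddCommGroup F] [Module ℂ F]

theorem RationalMap.map_smul (φ : RationalMap E F) (c : ℂ) (y : E) :
    φ.toFun (c • y) = c ^ φ.degree • φ.toFun y :=
  IsHomogeneousMap.map_smul φ.homogeneous c y

theorem RationalMap.mem_fiber_iff (φ : RationalMap E F) (x : ℙ ℂ F) (y : ℙ ℂ E) :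
    y ∈ φ.fiber x ↔ ∃ k : ℂ, k ≠ 0 ∧ φ.toFun y.rep = k • x.rep := by
  constructor
  · rintro ⟨hy, rfl⟩
    obtain ⟨c, hc0, hc⟩ := exists_rep_mk _ hy
    refine ⟨c⁻¹, inv_ne_zero hc0, ?_⟩
    rw [RationalMap.value, hc, smul_smul, inv_mul_cancel₀ hc0, one_smul]
  · rintro ⟨k, hk, h⟩
    have hy : φ.toFun y.rep ≠ 0 := by
      rw [h]
      exact smul_ne_zero hk x.rep_nonzero
    refine ⟨hy, ?_⟩
    change Projectivization.mk ℂ _ hy = x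
    conv_rhs => rw [← x.mk_rep]
    rw [Projectivization.mk_eq_mk_iff']
    exact ⟨k, h.symm⟩

/-- Homogeneity of φ lets the fibre be counted on arbitrary vectors up to scalars instead of chosen
representatives. -/
theorem RationalMap.ncard_fiber_eq_two (φ : RationalMap E F) (x : ℙ ℂ F) {y₁ y₂ : E}
    (hy : LinearIndependent ℂ ![y₁, y₂]) (h₁ : ∃ k : ℂ, k ≠ 0 ∧ φ.toFun y₁ = k • x.rep)
    (h₂ : ∃ k : ℂ, k ≠ 0 ∧ φ.toFun y₂ = k • x.rep)
    (h : ∀ (y : E) (k : ℂ), k ≠ 0 → φ.toFun y = k • x.rep → ∃ c : ℂ, y = c • y₁ ∨ y = c • y₂) :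
    (φ.fiber x).ncard = 2 := by
  have hy₁ : y₁ ≠ 0 := hy.ne_zero 0
  have hy₂ : y₂ ≠ 0 := hy.ne_zero 1
  have mem : ∀ (y : E) (hy : y ≠ 0), (∃ k : ℂ, k ≠ 0 ∧ φ.toFun y = k • x.rep) →
      Projectivization.mk ℂ y hy ∈ φ.fiber x := by
    rintro y hy ⟨k, hk, h⟩
    rw [φ.mem_fiber_iff]
    obtain ⟨c, hc0, hc⟩ := exists_rep_mk y hy
    exact ⟨c ^ φ.degree * k, mul_ne_zero (pow_ne_zero _ hc0) hk, by
      rw [hc, φ.map_smul, h, smul_smul]⟩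
  rw [Set.ncard_eq_two]
  refine ⟨Projectivization.mk ℂ y₁ hy₁, Projectivization.mk ℂ y₂ hy₂, ?_, ?_⟩
  · intro heq
    rw [Projectivization.mk_eq_mk_iff'] at heq
    obtain ⟨c, hc⟩ := heq
    have := LinearIndependent.pair_iff.mp hy 1 (-c) (by rw [← hc]; module)
    exact one_ne_zero this.1
  · ext y
    constructor
    · intro hyf
      obtain ⟨k, hk, hyk⟩ := (φ.mem_fiber_iff x y).mp hyf
      obtain ⟨c, hc⟩ := h _ k hk hyk
      rw [← y.mk_rep]
      rcases hc with hc | hc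
      · left
        rw [Projectivization.mk_eq_mk_iff']
        exact ⟨c, hc.symm⟩
      · right
        rw [Set.mem_singleton_iff, Projectivization.mk_eq_mk_iff']
        exact ⟨c, hc.symm⟩
    · rintro (rfl | rfl)
      · exact mem y₁ hy₁ h₁
      · exact mem y₂ hy₂ h₂

end Fiber

theorem IsHomogeneousPolynomial.comp_linear {E E' : Type*} [AddCommGroup E] [Module ℂ E]
    [AddCommGroup E'] [Module ℂ E'] {d : ℕ} {g : E → ℂ} (h : IsHomogeneousPolynomial d g)
    (A : E' →ₗ[ℂ] E) : IsHomogeneousPolynomial d (fun e => g (A e)) := by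
  obtain ⟨p, hp, hg⟩ := h
  refine ⟨MvPolynomial.rename (fun l : Module.Dual ℂ E => l.comp A) p, hp.rename_isHomogeneous,
    fun e => ?_⟩
  change g (A e) = _
  rw [hg, MvPolynomial.eval_rename]
  rfl

theorem isZariskiClosed_zeros {E : Type*} [AddCommGroup E] [Module ℂ E] {d : ℕ} {g : E → ℂ}
    (h : IsHomogeneousPolynomial d g) : IsZariskiClosed {x : ℙ ℂ E | g x.rep = 0} :=
  ⟨{g}, by rintro _ rfl; exact ⟨d, h⟩, by ext; simp⟩

/-! ### Generic conditions on X and the reduction to a fibre count. -/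

section Generic

variable {V : Type*} [AddCommGroup V] [Module ℂ V]

/-- `g` does not vanish identically on the fourfold. -/
def GenericallyNonzero (ω : Module.Dual ℂ (⋀[ℂ]^2 V)) (q : QuadraticForm ℂ (⋀[ℂ]^2 V))
    (g : ⋀[ℂ]^2 V → ℂ) : Prop :=
  ∃ x ∈ fourfold ω q, g x.rep ≠ 0

variable {ω : Module.Dual ℂ (⋀[ℂ]^2 V)} {q : QuadraticForm ℂ (⋀[ℂ]^2 V)}

/-- If the product vanished on X, irreducibility would put X in one of the two zero loci. So open
conditions verified at different points hold simultaneously somewhere. -/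
theorem GenericallyNonzero.mul (hX : IsZariskiIrreducible (fourfold ω q)) {d₁ d₂ : ℕ}
    {g₁ g₂ : ⋀[ℂ]^2 V → ℂ} (h₁ : IsHomogeneousPolynomial d₁ g₁)
    (h₂ : IsHomogeneousPolynomial d₂ g₂) (hg₁ : GenericallyNonzero ω q g₁)
    (hg₂ : GenericallyNonzero ω q g₂) : GenericallyNonzero ω q (fun η => g₁ η * g₂ η) := by
  obtain ⟨x₁, hx₁, h1⟩ := hg₁
  obtain ⟨x₂, hx₂, h2⟩ := hg₂
  by_contra hcon
  rw [GenericallyNonzero] at hcon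
  push Not at hcon
  rcases hX.2 _ _ (isZariskiClosed_zeros h₁) (isZariskiClosed_zeros h₂) (fun x hx => by
    rcases mul_eq_zero.mp (hcon x hx) with h | h
    · exact Or.inl h
    · exact Or.inr h) with h | h
  · exact h1 (h hx₁)
  · exact h2 (h hx₂)

/-- A homogeneous polynomial which is nonzero at all lifts of an isotropic pair `(t, w)` modulo the
kernel vector `v` does not vanish identically on the fourfold. -/
theorem genericallyNonzero_of_isotropic {v : V} (hvr : ∀ u, skew ω u v = 0) {d : ℕ}
    {g : ⋀[ℂ]^2 V → ℂ} (hg : IsHomogeneousPolynomial d g) (hg0 : g 0 = 0) {t w : V}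
    (htw : skew ω t w = 0) (ht : q (wedge v t) ≠ 0)
    (h : ∀ s : ℂ, q (wedge t (w + s • v)) = 0 → g (wedge t (w + s • v)) ≠ 0) :
    GenericallyNonzero ω q g := by
  -- Lifting w by s v moves t ∧ w along a line of direction v ∧ t. As q(v ∧ t) ≠ 0, some lift lies
  -- on the quadric, hence on X.
  obtain ⟨s, hs⟩ := exists_quadratic_root ht (-q.polarBilin (wedge t w) (wedge v t))
    (q (wedge t w))
  have hq : q (wedge t (w + s • v)) = 0 := by
    have e : wedge t (w + s • v) = wedge t w + (-s) • wedge v t := by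
      rw [wedge_add_right, wedge_smul_right, wedge_swap v t]; module
    rw [e, quad_add, quad_smul, map_smul, smul_eq_mul]
    linear_combination hs
  have hne := h s hq
  have h0 : wedge t (w + s • v) ≠ 0 := fun h0 => hne (by rw [h0, hg0])
  have hω : ω (wedge t (w + s • v)) = 0 := by
    rw [← skew_apply, map_add, map_smul, htw, hvr, smul_zero, add_zero]
  refine ⟨Projectivization.mk ℂ _ h0, mk_mem_fourfold h0 hω hq, ?_⟩
  obtain ⟨c, hc0, hc⟩ := exists_rep_mk _ h0
  rw [hc, hg.map_smul]
  exact mul_ne_zero (pow_ne_zero _ hc0) hne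

/-- Here û parametrises the cone Q = 0 and μ₁ : μ₂ is the fibre coordinate. Everything except the
count of preimages over g ≠ 0 is independent of their choice, so both shapes of Q are treated at
once. -/
theorem exists_doubleCover (hV : Module.finrank ℂ V = 5)
    (hX : IsZariskiIrreducible (fourfold ω q)) {v : V} (K : Chart ω v) {d e n : ℕ}
    {û : V → V} {μ₁ μ₂ : V → ℂ} (hu : IsHomogeneousMap d û) (h₁ : IsHomogeneousMap e μ₁)
    (h₂ : IsHomogeneousMap e μ₂) (hq : ∀ y, q (wedge v (û y)) = 0)
    {g : ⋀[ℂ]^2 V → ℂ} (hg : IsHomogeneousPolynomial n g) (hgX : GenericallyNonzero ω q g)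
    (hcount : ∀ a b, wedge a b ≠ 0 → ω (wedge a b) = 0 → q (wedge a b) = 0 → g (wedge a b) ≠ 0 →
      K.x₁ (contract V K.x₀ (wedge a b)) ≠ 0 ∧ ∃ y₁ y₂, LinearIndependent ℂ ![y₁, y₂] ∧
        (∃ k : ℂ, k ≠ 0 ∧ K.cover q (û y₁) (μ₁ y₁) (μ₂ y₁) = k • wedge a b) ∧
        (∃ k : ℂ, k ≠ 0 ∧ K.cover q (û y₂) (μ₁ y₂) (μ₂ y₂) = k • wedge a b) ∧
        ∀ (y : V) (k : ℂ), k ≠ 0 → K.cover q (û y) (μ₁ y) (μ₂ y) = k • wedge a b →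
          ∃ c : ℂ, y = c • y₁ ∨ y = c • y₂) :
    ∃ φ : RationalMap (Fin 5 → ℂ) (⋀[ℂ]^2 V),
      φ.IsRationalDoubleCover (fourfold ω q) ∧
        IsBuiltFromLines φ (fourfold ω q) (sigmaQuadric v q) := by
  have : Module.Finite ℂ V := Module.finite_of_finrank_pos (by omega)
  let ε : (Fin 5 → ℂ) ≃ₗ[ℂ] V := LinearEquiv.ofFinrankEq _ _ (by simp [hV])
  obtain ⟨N, hΦ⟩ := K.isHomogeneousMap_cover q hu h₁ h₂
  set Φ : V → ⋀[ℂ]^2 V := fun y => K.cover q (û y) (μ₁ y) (μ₂ y) with hΦdef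
  -- This Plücker coordinate vanishes on v ∧ V, so G ≠ 0 keeps φ(y) off Σ₀. By its formula on the
  -- cover it also forces v ∧ û ≠ 0 and a line transverse to the quadric at v ∧ û.
  let G : Module.Dual ℂ (⋀[ℂ]^2 V) := K.x₁.comp (contract V K.x₀)
  have hpoint : ∀ x ∈ fourfold ω q, g x.rep ≠ 0 → G x.rep ≠ 0 ∧
      ∃ y₁ y₂, LinearIndependent ℂ ![y₁, y₂] ∧ (∃ k : ℂ, k ≠ 0 ∧ Φ (ε y₁) = k • x.rep) ∧
        (∃ k : ℂ, k ≠ 0 ∧ Φ (ε y₂) = k • x.rep) ∧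
        ∀ (y : Fin 5 → ℂ) (k : ℂ), k ≠ 0 → Φ (ε y) = k • x.rep →
          ∃ c : ℂ, y = c • y₁ ∨ y = c • y₂ := by
    rintro x ⟨⟨a, b, hab⟩, hω, hqx⟩ hgx
    have hne := x.rep_nonzero
    rw [hab] at hω hqx hgx hne ⊢
    obtain ⟨hG, y₁, y₂, hy, hk₁, hk₂, huniq⟩ := hcount a b hne hω hqx hgx
    refine ⟨hG, ε.symm y₁, ε.symm y₂, ?_, by simpa using hk₁, by simpa using hk₂, ?_⟩
    · refine LinearIndependent.pair_iff.mpr fun x y h => LinearIndependent.pair_iff.mp hy x y ?_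
      have := congrArg ε h
      simpa using this
    · intro y k hk h
      obtain ⟨c, hc⟩ := huniq _ k hk h
      refine ⟨c, hc.imp (fun h => ?_) (fun h => ?_)⟩
      · rw [← map_smul, ← h, ε.symm_apply_apply]
      · rw [← map_smul, ← h, ε.symm_apply_apply]
  obtain ⟨x₀, hx₀, hgx₀⟩ := hgX
  obtain ⟨hG₀, z₀, z₁, hz₀, ⟨k₀, hk₀, hzk₀⟩, -⟩ := hpoint x₀ hx₀ hgx₀
  have hz₀0 : z₀ ≠ 0 := hz₀.ne_zero 0
  have hGz₀ : G (Φ (ε z₀)) ≠ 0 := by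
    rw [hzk₀, map_smul, smul_eq_mul]
    exact mul_ne_zero hk₀ hG₀
  let φ : RationalMap (Fin 5 → ℂ) (⋀[ℂ]^2 V) :=
    { toFun := fun y => Φ (ε y)
      degree := N
      homogeneous := fun l => (hΦ l).comp_linear ε.toLinearMap
      exists_ne_zero := ⟨z₀, fun h => hGz₀ (by rw [h, map_zero])⟩ }
  have hG : ∀ y, G (Φ y) = -(q.polarBilin (wedge v (û y))
      (wedge (û y) (K.transversal (û y) (μ₁ y) (μ₂ y))) * K.x₀ (û y) ^ 2) * μ₁ y :=
    fun y => K.x₁_contract_cover q _ _ _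
  have hgood : ∀ y, G (Φ y) ≠ 0 → wedge v (û y) ≠ 0 ∧
      q.polarBilin (wedge v (û y)) (Φ y) ≠ 0 := by
    intro y hy
    rw [hG] at hy
    constructor
    · intro h0
      apply hy
      rw [h0]
      simp
    · rw [hΦdef, K.polar_cover q (hq y)]
      intro h0
      apply hy
      rw [neg_eq_zero, pow_eq_zero_iff two_ne_zero] at h0
      rw [h0]
      simp
  let σ : RationalMap (Fin 5 → ℂ) (⋀[ℂ]^2 V) :=
    { toFun := fun y => wedge v (û (ε y))
      degree := d
      homogeneous := fun l => (hu.linear_comp (wedgeB V v) l).comp_linear ε.toLinearMap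
      exists_ne_zero := ⟨z₀, (hgood _ hGz₀).1⟩ }
  have hmaps : φ.MapsInto (fourfold ω q) := by
    intro y hy
    have hy' : Φ (ε y.rep) ≠ 0 := hy
    change Projectivization.mk ℂ (Φ (ε y.rep)) hy' ∈ _
    obtain ⟨s, hs⟩ := K.cover_eq_wedge q (û (ε y.rep)) (μ₁ (ε y.rep)) (μ₂ (ε y.rep))
    have hω := K.apply_cover q (û (ε y.rep)) (μ₁ (ε y.rep)) (μ₂ (ε y.rep))
    have hq' := K.quad_cover q (hq (ε y.rep)) (μ₁ (ε y.rep)) (μ₂ (ε y.rep))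
    simp only [hΦdef, hs] at hω hq' hy' ⊢
    exact mk_mem_fourfold hy' hω hq'
  have hfib : ∀ x ∈ fourfold ω q, g x.rep ≠ 0 → (φ.fiber x).ncard = 2 := by
    intro x hx hgx
    obtain ⟨-, y₁, y₂, hy, hk₁, hk₂, huniq⟩ := hpoint x hx hgx
    exact φ.ncard_fiber_eq_two x hy hk₁ hk₂ huniq
  refine ⟨φ, ⟨⟨hmaps, ?_⟩, {x | g x.rep = 0}, isZariskiClosed_zeros hg, fun h => hgx₀ (h hx₀),
    fun x hx hgx => hfib x hx hgx⟩, σ, ?_, {y | G (Φ (ε y.rep)) = 0},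
    isZariskiClosed_zeros ((hΦ G).comp_linear ε.toLinearMap), ?_, ?_⟩
  -- Dominance: every point with g ≠ 0 has a nonempty fibre, so X is contained in the union of Z and
  -- the zeros of g.
  · intro Z hZ hZφ
    rcases hX.2 Z _ hZ (isZariskiClosed_zeros hg) (fun x hx => by
      by_cases hgx : g x.rep = 0
      · exact Or.inr hgx
      · left
        have hne : (φ.fiber x).Nonempty := by
          rw [← Set.ncard_pos (Set.finite_of_ncard_ne_zero (by rw [hfib x hx hgx]; norm_num)),
            hfib x hx hgx]
          norm_num
        obtain ⟨y, hy, rfl⟩ := hne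
        exact hZφ y hy) with h | h
    · exact h
    · exact absurd (h hx₀) hgx₀
  · intro y hy
    exact mk_mem_sigmaQuadric _ (mem_star.mpr ⟨_, rfl⟩) (hq _)
  · intro h
    have h1 : G (Φ (ε (Projectivization.mk ℂ z₀ hz₀0).rep)) = 0 := h (Set.mem_univ _)
    obtain ⟨c, hc0, hc⟩ := exists_rep_mk z₀ hz₀0
    rw [hc, map_smul, hΦ.map_smul, map_smul, smul_eq_mul] at h1
    exact mul_ne_zero (pow_ne_zero _ hc0) hGz₀ h1
  · intro y _ hy
    have hy' : G (Φ (ε y.rep)) ≠ 0 := hy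
    obtain ⟨hp0, hb⟩ := hgood _ hy'
    have hΦ0 : Φ (ε y.rep) ≠ 0 := fun h => hy' (by rw [h, map_zero])
    refine ⟨hp0, hΦ0, ?_⟩
    have hqΦ : q (Φ (ε y.rep)) = 0 := K.quad_cover q (hq _) _ _
    obtain ⟨s, hs⟩ : ∃ s, Φ (ε y.rep) = wedge (û (ε y.rep)) s := K.cover_eq_wedge q _ _ _
    have hφX := hmaps y hΦ0
    change Projectivization.mk ℂ (Φ (ε y.rep)) hΦ0 ∈ _ at hφX
    have hqp := hq (ε y.rep)
    change lineThrough (Projectivization.mk ℂ (wedge v (û (ε y.rep))) hp0)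
        (Projectivization.mk ℂ (Φ (ε y.rep)) hΦ0) ⊆ grassmannian V ∧
      {z | z ∈ lineThrough (Projectivization.mk ℂ (wedge v (û (ε y.rep))) hp0)
        (Projectivization.mk ℂ (Φ (ε y.rep)) hΦ0) ∧ z ∈ fourfold ω q ∧ z ∉ sigmaQuadric v q}
        = {Projectivization.mk ℂ (Φ (ε y.rep)) hΦ0}
    set u := û (ε y.rep)
    set x := Φ (ε y.rep)
    obtain ⟨c₁, hc₁0, hc₁⟩ := exists_rep_mk (wedge v u) hp0
    obtain ⟨c₂, hc₂0, hc₂⟩ := exists_rep_mk x hΦ0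
    have hline : ∀ z ∈ lineThrough (Projectivization.mk ℂ (wedge v u) hp0)
        (Projectivization.mk ℂ x hΦ0), ∃ α β : ℂ, z.rep = α • wedge v u + β • x := by
      intro z hz
      obtain ⟨α, β, h⟩ := Submodule.mem_span_pair.mp hz
      rw [hc₁, hc₂, smul_smul, smul_smul] at h
      exact ⟨_, _, h.symm⟩
    constructor
    · intro z hz
      obtain ⟨α, β, h⟩ := hline z hz
      refine ⟨u, -(α • v) + β • s, ?_⟩
      rw [h, hs, wedge_add_right, wedge_neg_right, wedge_smul_right, wedge_smul_right,
        wedge_swap v u]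
      module
    · ext z
      constructor
      · rintro ⟨hz, hzX, hzS⟩
        obtain ⟨α, β, h⟩ := hline z hz
        have hqz := hzX.2.2
        rw [h, quad_add, quad_smul, quad_smul, hqΦ, hqp, map_smul, map_smul, LinearMap.smul_apply,
          smul_eq_mul, smul_eq_mul, mul_zero, mul_zero, zero_add, zero_add] at hqz
        -- On the line, q reduces to αβ times the polar of its two spanning points. β = 0 is the
        -- point of Σ₀, and the only other zero is α = 0, the point φ(y).
        have hβ : β ≠ 0 := by
          rintro rfl
          rw [zero_smul, add_zero] at h
          refine hzS ⟨?_, ?_⟩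
          · rw [h]
            exact Submodule.smul_mem _ _ (mem_star.mpr ⟨_, rfl⟩)
          · rw [h, quad_smul, hqp, mul_zero]
        have hα : α = 0 := by
          rcases mul_eq_zero.mp hqz with h | h
          · exact absurd h hβ
          · exact (mul_eq_zero.mp h).resolve_right hb
        rw [hα, zero_smul, zero_add] at h
        rw [Set.mem_singleton_iff]
        conv_lhs => rw [← z.mk_rep]
        rw [Projectivization.mk_eq_mk_iff']
        exact ⟨β, h.symm⟩
      · rintro rfl
        refine ⟨Submodule.subset_span (by simp), hφX, fun hS => ?_⟩
        obtain ⟨t, ht⟩ := mem_star.mp hS.1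
        have h1 := congrArg G ht
        rw [hc₂, map_smul, smul_eq_mul] at h1
        refine mul_ne_zero hc₂0 hy' (h1.symm.trans ?_)
        simp [G, K.x₀v, K.x₁v]

end Generic

/-! ### The open conditions, as polynomials in the bivector, and points where they hold. -/

section Conditions

variable {V : Type*} [AddCommGroup V] [Module ℂ V]

theorem quad_comb {W : Type*} [AddCommGroup W] [Module ℂ W] (Q : QuadraticForm ℂ W) (x y : ℂ)
    (a b : W) : Q (x • a - y • b) = x ^ 2 * Q a + y ^ 2 * Q b - x * y * Q.polarBilin a b := by
  have : x • a - y • b = x • a + (-y) • b := by module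
  rw [this, quad_add, quad_smul, quad_smul, map_smul, map_smul, LinearMap.smul_apply, smul_eq_mul,
    smul_eq_mul]
  ring

/-- A change of basis of the plane suffices: if Q a = Q b = 0, then Q(a + b) is the polar of a and
b, nonzero by the discriminant. -/
theorem exists_independent_discriminant {A : V →ₗ[ℂ] V →ₗ[ℂ] ℂ} (hA : ∀ x, A x x = 0)
    (Q : QuadraticForm ℂ V)
    (h : ∃ a b, A a b = 0 ∧ 4 * Q a * Q b - Q.polarBilin a b ^ 2 ≠ 0) :
    ∃ t w, A t w = 0 ∧ 4 * Q t * Q w - Q.polarBilin t w ^ 2 ≠ 0 ∧ Q t ≠ 0 := by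
  obtain ⟨a, b, hab, hD⟩ := h
  by_cases ha : Q a = 0
  · by_cases hb : Q b = 0
    · refine ⟨a + b, b, by rw [map_add, LinearMap.add_apply, hab, hA, add_zero], ?_, ?_⟩
      · rw [quad_add, map_add, LinearMap.add_apply, polarBilin_self]
        intro h0
        apply hD
        linear_combination h0
      · rw [quad_add, ha, hb]
        intro h0
        apply hD
        rw [ha]
        linear_combination -(Q.polarBilin a b) * h0
    · refine ⟨b, a, by rw [alt_swap hA, hab, neg_zero], ?_, hb⟩
      rw [polarBilin_comm]
      intro h0
      apply hD
      linear_combination h0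
  · exact ⟨a, b, hab, hD, ha⟩

theorem gram_add_left (q : QuadraticForm ℂ (⋀[ℂ]^2 V)) (v a b : V) :
    gram q v (a + b) b = gram q v a b := by
  simp only [gram, wedge_add_left, wedge_add_right, wedge_self, add_zero, quad_add, map_add,
    LinearMap.add_apply, polarBilin_self]
  ring

theorem gram_swap (q : QuadraticForm ℂ (⋀[ℂ]^2 V)) (v a b : V) :
    gram q v b a = gram q v a b := by
  rw [gram, gram, wedge_swap a b, QuadraticMap.map_neg, map_neg, LinearMap.neg_apply,
    LinearMap.neg_apply, polarBilin_comm q (wedge v b)]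
  ring

theorem gram_add_smul (q : QuadraticForm ℂ (⋀[ℂ]^2 V)) (v a b : V) (s : ℂ) :
    gram q v a (b + s • v) = gram q v a b := by
  have e : wedge a (b + s • v) = wedge a b + (-s) • wedge v a := by
    rw [wedge_add_right, wedge_smul_right, wedge_swap v a]; module
  have e' : wedge v (b + s • v) = wedge v b := by
    rw [wedge_add_right, wedge_smul_right, wedge_self, smul_zero, add_zero]
  rw [gram, gram, e, e']
  simp only [quad_add, quad_smul, map_add, map_smul, LinearMap.add_apply, LinearMap.smul_apply,
    smul_eq_mul, polarBilin_self]
  ring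

theorem exists_gram_ne_zero_of_left {ω : Module.Dual ℂ (⋀[ℂ]^2 V)}
    {q : QuadraticForm ℂ (⋀[ℂ]^2 V)} {v : V}
    (h : ∃ a b, skew ω a b = 0 ∧ gram q v a b ≠ 0) :
    ∃ t w, skew ω t w = 0 ∧ gram q v t w ≠ 0 ∧ q (wedge v t) ≠ 0 := by
  have hA := skew_self ω
  obtain ⟨a, b, hab, hD⟩ := h
  by_cases ha : q (wedge v a) = 0
  · by_cases hb : q (wedge v b) = 0
    · refine ⟨a + b, b, by rw [map_add, LinearMap.add_apply, hab, hA, add_zero],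
        by rwa [gram_add_left], ?_⟩
      rw [wedge_add_right, quad_add, ha, hb]
      intro h0
      apply hD
      rw [zero_add, zero_add] at h0
      rw [gram, ha, hb, h0]
      ring
    · exact ⟨b, a, by rw [alt_swap hA, hab, neg_zero], by rwa [gram_swap], hb⟩
  · exact ⟨a, b, hab, hD, ha⟩

/-- The linear form `u ↦ b_q(η, v ∧ u)`. -/
noncomputable def polarForm (q : QuadraticForm ℂ (⋀[ℂ]^2 V)) (v : V) :
    (⋀[ℂ]^2 V) →ₗ[ℂ] Module.Dual ℂ V :=
  (wedgeB V v).dualMap.comp q.polarBilin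

theorem polarForm_apply (q : QuadraticForm ℂ (⋀[ℂ]^2 V)) (v : V) (η : ⋀[ℂ]^2 V) (u : V) :
    polarForm q v η u = q.polarBilin η (wedge v u) := rfl

/-- The contracted vector is where u ↦ B(a ∧ b, v ∧ u) vanishes on the plane. So a nonzero `gram`
means that this polar is nonzero at the zeros of Q on the plane. -/
theorem coneForm_contract_polarForm (q : QuadraticForm ℂ (⋀[ℂ]^2 V)) (v : V) {a b : V}
    (hq : q (wedge a b) = 0) :
    coneForm q v (contract V (polarForm q v (wedge a b)) (wedge a b)) = -gram q v a b := by
  rw [contract_wedge, quad_comb, coneForm_polar, coneForm_apply, coneForm_apply, polarForm_apply,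
    polarForm_apply, gram, hq, polarBilin_comm q (wedge v b) (wedge v a)]
  ring

/-- Realises the discriminant of Q on the plane as a factor of a homogeneous polynomial in the
bivector alone. -/
theorem quad_contract_polar (Q : QuadraticForm ℂ V) (f : Module.Dual ℂ V) (a b : V) :
    Q (contract V (Q.polarBilin (contract V f (wedge a b))) (wedge a b))
      = (4 * Q a * Q b - Q.polarBilin a b ^ 2) * Q (contract V f (wedge a b)) := by
  simp only [contract_wedge, quad_comb, map_sub, map_smul, LinearMap.sub_apply,
    LinearMap.smul_apply, smul_eq_mul, polarBilin_self, polarBilin_comm Q b a]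
  ring

variable {ω : Module.Dual ℂ (⋀[ℂ]^2 V)} {q : QuadraticForm ℂ (⋀[ℂ]^2 V)} {v : V}

theorem homogeneous_contract [Module.Finite ℂ V] (Q : QuadraticForm ℂ V) (f : Module.Dual ℂ V) :
    IsHomogeneousPolynomial 2 (fun η => Q (contract V f η)) :=
  ((IsHomogeneousMap.of_linear (contract V f)).quadratic Q).polynomial

theorem homogeneous_contract_linear [Module.Finite ℂ V] (Q : QuadraticForm ℂ V)
    (f : (⋀[ℂ]^2 V) →ₗ[ℂ] Module.Dual ℂ V) :
    IsHomogeneousPolynomial 4 (fun η => Q (contract V (f η) η)) :=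
  ((IsHomogeneousMap.bilinear (contract V) (IsHomogeneousMap.of_linear f)
    (IsHomogeneousMap.of_linear LinearMap.id)).quadratic Q).polynomial

/-- The chart is built around a single isotropic pair (t, w) with Q(t) ≠ 0, x₀(t) = 0 and x₀(w) = 1.
Contraction with x₀ then returns -t. Taking c₁ = t - t' rather than t makes both x₁(t) and x₂(t)
equal to 1, so the three conditions hold at the same lifts. -/
theorem exists_chart (hV : Module.finrank ℂ V = 5) (hv : ∀ u, skew ω v u = 0)
    (hK : ∀ u, (∀ x, skew ω u x = 0) → u ∈ Submodule.span ℂ {v}) (hQ : ∃ t, q (wedge v t) ≠ 0) :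
    ∃ K : Chart ω v,
      GenericallyNonzero ω q (fun η => K.x₁ (contract V K.x₀ η)) ∧
      GenericallyNonzero ω q (fun η => K.x₂ (contract V K.x₀ η)) ∧
      GenericallyNonzero ω q (fun η => coneForm q v (contract V K.x₀ η)) := by
  have : Module.Finite ℂ V := Module.finite_of_finrank_pos (by omega)
  have hA := skew_self ω
  have hvr : ∀ u, skew ω u v = 0 := fun u => by rw [alt_swap hA, hv, neg_zero]
  obtain ⟨t, ht⟩ := hQ
  have htv : t ∉ Submodule.span ℂ {v} := by
    intro hmem
    obtain ⟨c, rfl⟩ := Submodule.mem_span_singleton.mp hmem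
    exact ht (by rw [wedge_smul_right, wedge_self, smul_zero, QuadraticMap.map_zero])
  obtain ⟨w, htw, hind⟩ := exists_isotropic hV htv
  obtain ⟨t', w', hF⟩ := exists_frame hA hK htw hind
  have e1 : skew ω t' t = -1 := by rw [alt_swap hA, hF.tt']
  have e6 : skew ω w' t' = 0 := by rw [alt_swap hA, hF.t'w', neg_zero]
  let K : Chart ω v :=
    { c₀ := w
      c₁ := t - t'
      c₂ := t'
      c₃ := w'
      x₀ := (skew ω).flip w'
      x₁ := (skew ω).flip t'
      x₂ := skew ω (t - t')
      x₀v := by simp [hv]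
      x₁v := by simp [hv]
      x₂v := by simp [hvr]
      x₀c₁ := by simp [hF.tw', hF.t'w']
      x₀c₂ := by simp [hF.t'w']
      x₀c₃ := by simp [hA]
      x₁c₁ := by simp [hF.tt', hA]
      x₁c₂ := by simp [hA]
      x₁c₃ := by simp [e6]
      x₂c₁ := hA _
      x₂c₂ := by simp [hF.tt', hA]
      x₂c₃ := by simp [hF.tw', hF.t'w']
      skew_v := hvr
      skew_c₁ := fun u => alt_swap hA _ _
      skew_c₂ := fun u => rfl
      skew_c₃ := fun u => rfl
      expand := fun u => by
        obtain ⟨s, hs⟩ := hF.expand hV hA hK u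
        refine ⟨s, skew ω w u, ?_⟩
        conv_lhs => rw [hs]
        simp only [LinearMap.flip_apply, map_sub, LinearMap.sub_apply, alt_swap hA u t']
        module }
  have hx₀t : K.x₀ t = 0 := hF.tw'
  have hx₀w : K.x₀ w = 1 := hF.ww'
  have hx₁t : K.x₁ t = 1 := hF.tt'
  have hx₂t : K.x₂ t = 1 := by
    change skew ω (t - t') t = 1
    simp [hA, e1]
  refine ⟨K, ?_, ?_, ?_⟩
  · refine genericallyNonzero_of_isotropic hvr
      (IsHomogeneousPolynomial.of_linear (K.x₁.comp (contract V K.x₀))) (by simp) htw ht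
      fun s _ => ?_
    simp [hx₀t, hx₀w, hx₁t, K.x₀v]
  · refine genericallyNonzero_of_isotropic hvr
      (IsHomogeneousPolynomial.of_linear (K.x₂.comp (contract V K.x₀))) (by simp) htw ht
      fun s _ => ?_
    simp [hx₀t, hx₀w, hx₂t, K.x₀v]
  · refine genericallyNonzero_of_isotropic hvr (homogeneous_contract _ _) (by simp) htw ht
      fun s _ => ?_
    simpa [hx₀t, hx₀w, K.x₀v, coneForm_apply] using ht

theorem genericallyNonzero_polarForm [Module.Finite ℂ V] (hv : ∀ u, skew ω v u = 0)
    (h : ∃ a b, skew ω a b = 0 ∧ gram q v a b ≠ 0) :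
    GenericallyNonzero ω q (fun η => coneForm q v (contract V (polarForm q v η) η)) := by
  obtain ⟨t, w, htw, hg, ht⟩ := exists_gram_ne_zero_of_left h
  refine genericallyNonzero_of_isotropic
    (fun u => by rw [alt_swap (skew_self ω), hv, neg_zero])
    (homogeneous_contract_linear _ (polarForm q v)) (by simp) htw ht fun s hs => ?_
  rw [coneForm_contract_polarForm q v hs, gram_add_smul]
  exact neg_ne_zero.mpr hg

theorem exists_genericallyNonzero_discriminant [Module.Finite ℂ V] (hv : ∀ u, skew ω v u = 0)
    (hK : ∀ u, (∀ x, skew ω u x = 0) → u ∈ Submodule.span ℂ {v})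
    (h : ∃ a b, skew ω a b = 0 ∧
      4 * coneForm q v a * coneForm q v b - (coneForm q v).polarBilin a b ^ 2 ≠ 0) :
    ∃ f : Module.Dual ℂ V, GenericallyNonzero ω q (fun η =>
      coneForm q v (contract V ((coneForm q v).polarBilin (contract V f η)) η)) := by
  have hA := skew_self ω
  have hvr : ∀ u, skew ω u v = 0 := fun u => by rw [alt_swap hA, hv, neg_zero]
  obtain ⟨t, w, htw, hD, ht⟩ := exists_independent_discriminant hA _ h
  obtain ⟨t', w', hF⟩ := exists_frame hA hK htw
    (independent_mod_of_discriminant _ (coneForm_polar_self q v) hD)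
  refine ⟨(skew ω).flip w', genericallyNonzero_of_isotropic hvr
    (homogeneous_contract_linear _ ((coneForm q v).polarBilin.comp (contract V _))) (by simp) htw
    ht fun s hs => ?_⟩
  rw [quad_contract_polar]
  have e1 : coneForm q v (w + s • v) = coneForm q v w := by
    rw [coneForm_apply, coneForm_apply, wedge_add_right, wedge_smul_right, wedge_self, smul_zero,
      add_zero]
  have e2 : (coneForm q v).polarBilin t (w + s • v) = (coneForm q v).polarBilin t w := by
    rw [map_add, map_smul, polarBilin_comm _ t v, coneForm_polar_self, smul_zero, add_zero]
  rw [e1, e2]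
  refine mul_ne_zero hD ?_
  simpa [hF.tw', hF.ww', hv] using ht

/-- Project x to the hyperplane l = 0 along e and expand Q there; every remaining term contains l x.
-/
theorem exists_factor_of_zero_on_ker {W : Type*} [AddCommGroup W] [Module ℂ W]
    (Q : QuadraticForm ℂ W) (l : Module.Dual ℂ W) {e : W} (he : l e ≠ 0)
    (h : ∀ x, l x = 0 → Q x = 0) : ∃ m : Module.Dual ℂ W, ∀ x, Q x = l x * m x := by
  refine ⟨(l e)⁻¹ • Q.polarBilin e - (Q e / l e ^ 2) • l, fun x => ?_⟩
  have h1 := h (x - (l x / l e) • e) (by simp [he])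
  have h2 := quad_comb Q 1 (l x / l e) x e
  rw [one_smul, h1, polarBilin_comm] at h2
  rw [LinearMap.sub_apply, LinearMap.smul_apply, LinearMap.smul_apply, smul_eq_mul, smul_eq_mul]
  field_simp at h2 ⊢
  linear_combination -h2

/-- Ensures that, for a general point of X, the polar of e₀ is nonzero at the zeros of Q on the
plane, so that these can be reached by projection from e₀. -/
theorem genericallyNonzero_polar_root [Module.Finite ℂ V] (hv : ∀ u, skew ω v u = 0)
    (hK : ∀ u, (∀ x, skew ω u x = 0) → u ∈ Submodule.span ℂ {v})
    (hirr : ¬ ∃ l m : Module.Dual ℂ V, ∀ u, coneForm q v u = l u * m u) {e₀ r : V}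
    (he₀ : coneForm q v e₀ = 0) (hr : (coneForm q v).polarBilin e₀ r ≠ 0) :
    GenericallyNonzero ω q (fun η =>
      coneForm q v (contract V ((coneForm q v).polarBilin e₀) η)) := by
  have hA := skew_self ω
  have hvr : ∀ u, skew ω u v = 0 := fun u => by rw [alt_swap hA, hv, neg_zero]
  set Q := coneForm q v with hQ
  set f := Q.polarBilin e₀ with hf
  have hfv : f v = 0 := by rw [hf, polarBilin_comm, coneForm_polar_self]
  have hfe : f e₀ = 0 := by rw [hf, polarBilin_self, he₀, mul_zero]
  obtain ⟨t, w, hft, ht, htw, hfw⟩ : ∃ t w, f t = 0 ∧ Q t ≠ 0 ∧ skew ω t w = 0 ∧ f w ≠ 0 := by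
    obtain ⟨t, hft, ht⟩ : ∃ t, f t = 0 ∧ Q t ≠ 0 := by
      by_contra! hcon
      obtain ⟨m, hm⟩ := exists_factor_of_zero_on_ker Q f hr hcon
      exact hirr ⟨f, m, hm⟩
    -- Otherwise the polar f is a multiple of both ω(t, ·) and ω(t + e₀, ·). Comparing the two gives
    -- a kernel vector, which forces both multiples to be zero, and hence f = 0.
    by_contra! hcon
    have ht₂ : Q (t + e₀) = Q t := by
      rw [quad_add, he₀, polarBilin_comm, ← hf, hft]; ring
    obtain ⟨c, hc⟩ := exists_smul_eq_of_ker_le (skew ω t) f (fun x hx => hcon t x hft ht hx)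
    obtain ⟨c', hc'⟩ := exists_smul_eq_of_ker_le (skew ω (t + e₀)) f
      (fun x hx => hcon (t + e₀) x (by rw [map_add, hft, hfe, add_zero]) (by rwa [ht₂]) hx)
    have hmem := hK ((c - c') • t - c' • e₀) fun x => by
      have h1 := hc x
      have h2 := hc' x
      rw [map_add, LinearMap.add_apply] at h2
      simp only [map_sub, map_smul, LinearMap.sub_apply, LinearMap.smul_apply, smul_eq_mul]
      linear_combination h2 - h1
    obtain ⟨n, hn⟩ := Submodule.mem_span_singleton.mp hmem
    have h1 := congrArg Q hn
    rw [quad_smul, hQ, coneForm_self, ← hQ, quad_comb, he₀, polarBilin_comm, ← hf, hft] at h1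
    have hcc : c - c' = 0 := by
      have : (c - c') ^ 2 * Q t = 0 := by linear_combination -h1
      exact pow_eq_zero_iff two_ne_zero |>.mp ((mul_eq_zero.mp this).resolve_right ht)
    rw [hcc, zero_smul, zero_sub] at hn
    have h2 := congrArg (fun x => Q.polarBilin x r) hn
    simp only [map_neg, map_smul, LinearMap.neg_apply, LinearMap.smul_apply, smul_eq_mul,
      ← hf] at h2
    rw [hQ, coneForm_polar_self, mul_zero] at h2
    have hc'0 : c' = 0 := by
      have : c' * f r = 0 := by linear_combination h2
      exact (mul_eq_zero.mp this).resolve_right hr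
    apply hr
    rw [hc' r, hc'0, zero_mul]
  refine genericallyNonzero_of_isotropic hvr (homogeneous_contract _ _) (by simp) htw ht
    fun s _ => ?_
  have : contract V f (wedge t (w + s • v)) = (-f w) • t := by
    simp [hft, hfv]
  rw [this, quad_smul]
  exact mul_ne_zero (pow_ne_zero 2 (neg_ne_zero.mpr hfw)) ht

end Conditions

/-! ### The two preimages of a general point. -/

section Count

variable {V : Type*} [AddCommGroup V] [Module ℂ V]
variable {ω : Module.Dual ℂ (⋀[ℂ]^2 V)} {q : QuadraticForm ℂ (⋀[ℂ]^2 V)} {v : V}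

/-- The two contraction hypotheses say that x₀ and the polar do not vanish at a zero of Q on the
plane, so every such zero r yields a line with residual point a ∧ b. -/
theorem Chart.exists_cover_eq (K : Chart ω v) {a b : V} (hω : ω (wedge a b) = 0)
    (hq : q (wedge a b) = 0) (h₁ : coneForm q v (contract V K.x₀ (wedge a b)) ≠ 0)
    (h₂ : coneForm q v (contract V (polarForm q v (wedge a b)) (wedge a b)) ≠ 0) {r s : V} {k : ℂ}
    (hk : k ≠ 0) (hab : wedge a b ≠ 0) (hr : wedge r s = k • wedge a b)
    (hQ : coneForm q v r = 0) {m : ℂ} (hm : m ≠ 0) :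
    ∃ k : ℂ, k ≠ 0 ∧ K.cover q r (m * K.x₁ (contract V K.x₀ (wedge a b)))
      (m * K.x₂ (contract V K.x₀ (wedge a b))) = k • wedge a b := by
  have hr0 : r ≠ 0 := by
    rintro rfl
    rw [wedge_zero_left] at hr
    exact smul_ne_zero hk hab hr.symm
  obtain ⟨α, β, rfl⟩ := mem_plane_of_wedge_eq hk hab hr
  have h3 := apply_ne_zero_of_contract h₁ hr0 hQ
  have h4 := apply_ne_zero_of_contract h₂ hr0 hQ
  obtain ⟨t, ht⟩ := exists_wedge_eq_of_ne_zero hr0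
  rw [← ht] at hω hq h4 ⊢
  rw [polarForm_apply, polarBilin_comm] at h4
  exact K.cover_eq_smul q hω hq hQ h3 h4 hm

theorem Chart.parameters_of_cover_eq (K : Chart ω v) {η : ⋀[ℂ]^2 V} {u : V} {m₁ m₂ k : ℂ}
    (hk : k ≠ 0) (hη : K.x₁ (contract V K.x₀ η) ≠ 0) (h : K.cover q u m₁ m₂ = k • η) :
    m₁ ≠ 0 ∧ m₂ * K.x₁ (contract V K.x₀ η) = m₁ * K.x₂ (contract V K.x₀ η) := by
  have h1 := K.x₁_contract_cover q u m₁ m₂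
  have h2 := K.x₂_contract_cover q u m₁ m₂
  rw [h, map_smul, map_smul, smul_eq_mul] at h1 h2
  refine ⟨?_, ?_⟩
  · rintro rfl
    rw [mul_zero] at h1
    exact mul_ne_zero hk hη h1
  · have : k * (m₂ * K.x₁ (contract V K.x₀ η) - m₁ * K.x₂ (contract V K.x₀ η)) = 0 := by
      linear_combination m₂ * h1 - m₁ * h2
    exact sub_eq_zero.mp ((mul_eq_zero.mp this).resolve_left hk)

/-- The fibres of the cover, when the cone over the `σ`-quadric is parametrised by projection from
its point `e₀`. -/
theorem Chart.count_of_projection (K : Chart ω v) {e₀ : V} (he₀ : coneForm q v e₀ = 0)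
    (τ : Module.Dual ℂ V) (hτ : τ e₀ = 1) {a b : V} (hab : wedge a b ≠ 0) (hω : ω (wedge a b) = 0)
    (hq : q (wedge a b) = 0) (hx₁ : K.x₁ (contract V K.x₀ (wedge a b)) ≠ 0)
    (h₁ : coneForm q v (contract V K.x₀ (wedge a b)) ≠ 0)
    (h₂ : coneForm q v (contract V (polarForm q v (wedge a b)) (wedge a b)) ≠ 0)
    (h₃ : coneForm q v (contract V ((coneForm q v).polarBilin e₀) (wedge a b)) ≠ 0)
    (hD : 4 * coneForm q v a * coneForm q v b - (coneForm q v).polarBilin a b ^ 2 ≠ 0) :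
    ∃ y₁ y₂, LinearIndependent ℂ ![y₁, y₂] ∧
      (∃ k : ℂ, k ≠ 0 ∧ K.cover q (coneForm q v y₁ • e₀ - (coneForm q v).polarBilin e₀ y₁ • y₁)
        ((coneForm q v).polarBilin e₀ y₁) (τ y₁) = k • wedge a b) ∧
      (∃ k : ℂ, k ≠ 0 ∧ K.cover q (coneForm q v y₂ • e₀ - (coneForm q v).polarBilin e₀ y₂ • y₂)
        ((coneForm q v).polarBilin e₀ y₂) (τ y₂) = k • wedge a b) ∧
      ∀ (y : V) (k : ℂ), k ≠ 0 →
        K.cover q (coneForm q v y • e₀ - (coneForm q v).polarBilin e₀ y • y)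
          ((coneForm q v).polarBilin e₀ y) (τ y) = k • wedge a b →
        ∃ c : ℂ, y = c • y₁ ∨ y = c • y₂ := by
  set Q := coneForm q v with hQdef
  set f := Q.polarBilin e₀ with hf
  have hfe : f e₀ = 0 := by rw [hf, polarBilin_self, he₀, mul_zero]
  obtain ⟨r₁, r₂, k₀, hr₁, hr₂, hB, hk₀, hη⟩ := exists_roots hD
  have hr₁₂ : wedge r₁ r₂ ≠ 0 := by
    intro h0
    rw [h0, smul_zero] at hη
    exact hab hη
  have hw₁ : wedge r₁ r₂ = k₀⁻¹ • wedge a b := by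
    rw [hη, smul_smul, inv_mul_cancel₀ hk₀, one_smul]
  have hw₂ : wedge r₂ r₁ = (-k₀⁻¹) • wedge a b := by
    rw [wedge_swap r₁ r₂, hw₁]; module
  have hk₁ : k₀⁻¹ ≠ 0 := inv_ne_zero hk₀
  set x₁ := K.x₁ (contract V K.x₀ (wedge a b))
  set x₂ := K.x₂ (contract V K.x₀ (wedge a b))
  have hfr : ∀ (r s : V) (k : ℂ), k ≠ 0 → wedge r s = k • wedge a b → Q r = 0 → f r ≠ 0 := by
    intro r s k hk h hr
    obtain ⟨α, β, rfl⟩ := mem_plane_of_wedge_eq hk hab h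
    refine apply_ne_zero_of_contract h₃ (fun h0 => ?_) hr
    rw [h0, wedge_zero_left] at h
    exact smul_ne_zero hk hab h.symm
  have hf₁ := hfr r₁ r₂ _ hk₁ hw₁ hr₁
  have hf₂ := hfr r₂ r₁ _ (neg_ne_zero.mpr hk₁) hw₂ hr₂
  have hQY : ∀ (r : V) (δ : ℂ), Q r = 0 → Q (r + δ • e₀) = δ * f r := by
    intro r δ hr
    rw [quad_add, quad_smul, hr, he₀, map_smul, polarBilin_comm, ← hf, smul_eq_mul]
    ring
  have hfY : ∀ (r : V) (δ : ℂ), f (r + δ • e₀) = f r := by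
    intro r δ
    rw [map_add, map_smul, hfe, smul_zero, add_zero]
  -- Moving r along e₀ changes neither f nor the projected point, which is -f(r) r. The displacement
  -- is the one making τ : f equal to the required ratio x₂ : x₁.
  have exist : ∀ (r s : V) (k : ℂ), k ≠ 0 → wedge r s = k • wedge a b → Q r = 0 → f r ≠ 0 →
      ∃ k : ℂ, k ≠ 0 ∧ K.cover q
        (Q (r + (f r * (x₂ / x₁) - τ r) • e₀) • e₀
          - f (r + (f r * (x₂ / x₁) - τ r) • e₀) • (r + (f r * (x₂ / x₁) - τ r) • e₀))
        (f (r + (f r * (x₂ / x₁) - τ r) • e₀)) (τ (r + (f r * (x₂ / x₁) - τ r) • e₀))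
          = k • wedge a b := by
    intro r s k hk h hr hfr
    have e1 : τ (r + (f r * (x₂ / x₁) - τ r) • e₀) = (f r / x₁) * x₂ := by
      rw [map_add, map_smul, hτ, smul_eq_mul]; ring
    have e2 : f (r + (f r * (x₂ / x₁) - τ r) • e₀) = (f r / x₁) * x₁ := by
      rw [hfY]; field_simp
    have e3 : Q (r + (f r * (x₂ / x₁) - τ r) • e₀) • e₀
          - f (r + (f r * (x₂ / x₁) - τ r) • e₀) • (r + (f r * (x₂ / x₁) - τ r) • e₀)
          = (-f r) • r := by
      rw [hQY _ _ hr, hfY]; module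
    rw [e3, e2, e1]
    refine K.exists_cover_eq hω hq h₁ h₂ (s := s) (k := -f r * k)
      (mul_ne_zero (neg_ne_zero.mpr hfr) hk) hab ?_ ?_ (div_ne_zero hfr hx₁)
    · rw [wedge_smul_left, h, smul_smul]
    · rw [← hQdef, quad_smul, hr, mul_zero]
  have uniq : ∀ (r y : V) (α : ℂ), Q y • e₀ - f y • y = α • r → f y ≠ 0 →
      τ y * x₁ = f y * x₂ → ∃ c : ℂ, y = c • (r + (f r * (x₂ / x₁) - τ r) • e₀) := by
    intro r y α h hfy hτy
    refine ⟨-(α / f y), ?_⟩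
    have hy : y = (-(α / f y)) • r + (Q y / f y) • e₀ := by
      have : f y • y = (-α) • r + Q y • e₀ := by
        rw [neg_smul, ← h]; abel
      calc y = (f y)⁻¹ • (f y • y) := by rw [smul_smul, inv_mul_cancel₀ hfy, one_smul]
        _ = _ := by rw [this]; module
    have h1 := congrArg f hy
    have h2 := congrArg τ hy
    rw [map_add, map_smul, map_smul, hfe, smul_zero, add_zero, smul_eq_mul] at h1
    rw [map_add, map_smul, map_smul, hτ, smul_eq_mul, smul_eq_mul, mul_one] at h2
    have h3 : Q y / f y = (-(α / f y)) * (f r * (x₂ / x₁) - τ r) := by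
      have h4 : τ y = f y * (x₂ / x₁) := by
        field_simp
        linear_combination hτy
      rw [mul_sub, ← mul_assoc, ← h1, ← h4]
      linear_combination -h2
    conv_lhs => rw [hy, h3]
    module
  refine ⟨_, _, ?_, exist r₁ r₂ _ hk₁ hw₁ hr₁ hf₁,
    exist r₂ r₁ _ (neg_ne_zero.mpr hk₁) hw₂ hr₂ hf₂, ?_⟩
  · refine LinearIndependent.pair_iff.mpr fun x y h => ?_
    set δ₁ := f r₁ * (x₂ / x₁) - τ r₁
    set δ₂ := f r₂ * (x₂ / x₁) - τ r₂
    -- Applying Q kills the right-hand side and gives x y = 0, since the polar of r₁ and r₂ is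
    -- nonzero; applying f then kills the remaining coefficient.
    have h' : x • r₁ - (-y) • r₂ = (-(x * δ₁ + y * δ₂)) • e₀ := by
      rw [← sub_eq_zero, ← h]; module
    have h1 := congrArg Q h'
    have h2 := congrArg f h'
    rw [quad_comb, quad_smul, hr₁, hr₂, he₀] at h1
    simp only [map_sub, map_smul, smul_eq_mul, hfe] at h2
    have h3 : x * y = 0 := by
      have : x * y * Q.polarBilin r₁ r₂ = 0 := by linear_combination h1
      exact (mul_eq_zero.mp this).resolve_right hB
    rcases mul_eq_zero.mp h3 with hx | hy
    · refine ⟨hx, (mul_eq_zero.mp (?_ : y * f r₂ = 0)).resolve_right hf₂⟩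
      rw [hx] at h2
      linear_combination h2
    · refine ⟨(mul_eq_zero.mp (?_ : x * f r₁ = 0)).resolve_right hf₁, hy⟩
      rw [hy] at h2
      linear_combination h2
  · intro y k hk h
    obtain ⟨hfy, hτy⟩ := K.parameters_of_cover_eq hk hx₁ h
    obtain ⟨s, hs⟩ := K.cover_eq_wedge q (Q y • e₀ - f y • y) (f y) (τ y)
    rw [h, hη, smul_smul] at hs
    obtain ⟨α, β, hαβ⟩ := mem_plane_of_wedge_eq (mul_ne_zero hk hk₀) hr₁₂ hs.symm
    have hQu : Q (Q y • e₀ - f y • y) = 0 := by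
      rw [quad_comb, he₀, ← hf]; ring
    have hprod : α * β = 0 := by
      rw [hαβ, quad_add, quad_smul, quad_smul, hr₁, hr₂, map_smul, map_smul,
        LinearMap.smul_apply, smul_eq_mul, smul_eq_mul] at hQu
      have : α * β * Q.polarBilin r₁ r₂ = 0 := by linear_combination hQu
      exact (mul_eq_zero.mp this).resolve_right hB
    rcases mul_eq_zero.mp hprod with h0 | h0
    · rw [h0, zero_smul, zero_add] at hαβ
      obtain ⟨c, hc⟩ := uniq r₂ y β hαβ hfy hτy
      exact ⟨c, Or.inr hc⟩
    · rw [h0, zero_smul, add_zero] at hαβ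
      obtain ⟨c, hc⟩ := uniq r₁ y α hαβ hfy hτy
      exact ⟨c, Or.inl hc⟩

/-- The fibres of the cover, when the cone over the `σ`-quadric contains the hyperplane `l = 0`. -/
theorem Chart.count_of_hyperplane (K : Chart ω v) {l m : Module.Dual ℂ V}
    (hlm : ∀ u, coneForm q v u = l u * m u) {e : V} (he : l e = 1) {a b : V}
    (hab : wedge a b ≠ 0) (hω : ω (wedge a b) = 0)
    (hq : q (wedge a b) = 0) (hx₁ : K.x₁ (contract V K.x₀ (wedge a b)) ≠ 0)
    (hx₂ : K.x₂ (contract V K.x₀ (wedge a b)) ≠ 0)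
    (h₁ : coneForm q v (contract V K.x₀ (wedge a b)) ≠ 0)
    (h₂ : coneForm q v (contract V (polarForm q v (wedge a b)) (wedge a b)) ≠ 0) :
    ∃ y₁ y₂, LinearIndependent ℂ ![y₁, y₂] ∧
      (∃ k : ℂ, k ≠ 0 ∧ K.cover q (y₁ - l y₁ • e) (K.x₀ (y₁ - l y₁ • e) * K.x₀ (y₁ - l y₁ • e))
        (l y₁ * l y₁) = k • wedge a b) ∧
      (∃ k : ℂ, k ≠ 0 ∧ K.cover q (y₂ - l y₂ • e) (K.x₀ (y₂ - l y₂ • e) * K.x₀ (y₂ - l y₂ • e))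
        (l y₂ * l y₂) = k • wedge a b) ∧
      ∀ (y : V) (k : ℂ), k ≠ 0 →
        K.cover q (y - l y • e) (K.x₀ (y - l y • e) * K.x₀ (y - l y • e)) (l y * l y)
          = k • wedge a b →
        ∃ c : ℂ, y = c • y₁ ∨ y = c • y₂ := by
  have hl : ¬ (l a = 0 ∧ l b = 0) := by
    rintro ⟨ha, hb⟩
    apply h₁
    rw [hlm, contract_wedge, map_sub, map_smul, map_smul, ha, hb]
    simp
  -- The zero of l on the plane, the only zero of Q used in this case.
  set r := (-l b) • a + l a • b with hr
  have hlr : l r = 0 := by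
    rw [hr, map_add, map_smul, map_smul, smul_eq_mul, smul_eq_mul]; ring
  have hr0 : r ≠ 0 := by
    intro h0
    apply hl
    have ha := congrArg (wedge a) h0
    have hb := congrArg (wedge b) h0
    rw [hr, wedge_add_right, wedge_smul_right, wedge_smul_right, wedge_self, wedge_zero_right,
      smul_zero, zero_add] at ha
    rw [hr, wedge_add_right, wedge_smul_right, wedge_smul_right, wedge_self, wedge_zero_right,
      smul_zero, add_zero, wedge_swap a b] at hb
    exact ⟨(smul_eq_zero.mp ha).resolve_right hab,
      by simpa using (smul_eq_zero.mp hb).resolve_right (neg_ne_zero.mpr hab)⟩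
  have hQr : coneForm q v r = 0 := by rw [hlm, hlr, zero_mul]
  have hx₀ : K.x₀ r ≠ 0 := apply_ne_zero_of_contract h₁ hr0 hQr
  obtain ⟨s, hs⟩ := exists_wedge_eq_of_ne_zero hr0
  set x₁ := K.x₁ (contract V K.x₀ (wedge a b))
  set x₂ := K.x₂ (contract V K.x₀ (wedge a b))
  -- The fibre coordinate is x₀(r)² : l(y)², so the two preimages correspond to the two square roots
  -- of x₂/x₁; they are distinct because x₂ ≠ 0.
  obtain ⟨ρ, hρ⟩ := IsAlgClosed.exists_pow_nat_eq (x₂ / x₁) (n := 2) (by norm_num)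
  have hρ0 : ρ ≠ 0 := by
    rintro rfl
    exact div_ne_zero hx₂ hx₁ (by rw [← hρ]; norm_num)
  have hly : ∀ κ : ℂ, l (r + κ • e) = κ := fun κ => by
    rw [map_add, map_smul, hlr, he, smul_eq_mul, mul_one, zero_add]
  have exist : ∀ κ : ℂ, κ ^ 2 = K.x₀ r ^ 2 * (x₂ / x₁) → ∃ k : ℂ, k ≠ 0 ∧
      K.cover q ((r + κ • e) - l (r + κ • e) • e)
        (K.x₀ ((r + κ • e) - l (r + κ • e) • e) * K.x₀ ((r + κ • e) - l (r + κ • e) • e))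
        (l (r + κ • e) * l (r + κ • e)) = k • wedge a b := by
    intro κ hκ
    rw [hly, add_sub_cancel_right]
    have e1 : K.x₀ r * K.x₀ r = (K.x₀ r ^ 2 / x₁) * x₁ := by field_simp
    have e2 : κ * κ = (K.x₀ r ^ 2 / x₁) * x₂ := by
      rw [← pow_two, hκ]; ring
    rw [e1, e2]
    exact K.exists_cover_eq hω hq h₁ h₂ (s := s) (k := 1) one_ne_zero hab (by rw [hs, one_smul])
      hQr (div_ne_zero (pow_ne_zero 2 hx₀) hx₁)
  refine ⟨r + (K.x₀ r * ρ) • e, r + (-(K.x₀ r * ρ)) • e, ?_, exist _ (by rw [mul_pow, hρ]),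
    exist _ (by rw [neg_sq, mul_pow, hρ]), ?_⟩
  · refine LinearIndependent.pair_iff.mpr fun x y h => ?_
    have h1 := congrArg l h
    rw [map_add, map_smul, map_smul, hly, hly, map_zero, smul_eq_mul, smul_eq_mul] at h1
    have hxy : x = y := by
      have : (x - y) * (K.x₀ r * ρ) = 0 := by linear_combination h1
      exact sub_eq_zero.mp ((mul_eq_zero.mp this).resolve_right (mul_ne_zero hx₀ hρ0))
    subst hxy
    have h2 : (2 * x) • r = 0 := by rw [← h]; module
    have hx : x = 0 := by simpa [hr0] using h2
    exact ⟨hx, hx⟩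
  · intro y k hk h
    obtain ⟨hm, hly₂⟩ := K.parameters_of_cover_eq hk hx₁ h
    obtain ⟨t, ht⟩ := K.cover_eq_wedge q (y - l y • e)
      (K.x₀ (y - l y • e) * K.x₀ (y - l y • e)) (l y * l y)
    rw [h] at ht
    obtain ⟨α, β, hαβ⟩ := mem_plane_of_wedge_eq hk hab ht.symm
    have hlu : l (y - l y • e) = 0 := by rw [map_sub, map_smul, he, smul_eq_mul, mul_one, sub_self]
    obtain ⟨c, hc⟩ : ∃ c : ℂ, y - l y • e = c • r := by
      rw [hαβ, map_add, map_smul, map_smul, smul_eq_mul, smul_eq_mul] at hlu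
      rw [hαβ, hr]
      by_cases ha : l a = 0
      · have hb : l b ≠ 0 := fun hb => hl ⟨ha, hb⟩
        have hβ : β = 0 := by
          rw [ha, mul_zero, zero_add] at hlu
          exact (mul_eq_zero.mp hlu).resolve_right hb
        refine ⟨-(α / l b), ?_⟩
        rw [hβ, ha, zero_smul, add_zero, add_zero, smul_smul]
        congr 1
        field_simp
      · refine ⟨β / l a, ?_⟩
        rw [smul_add, smul_smul, smul_smul]
        congr 2
        · field_simp
          linear_combination hlu
        · field_simp
    rw [hc, map_smul, smul_eq_mul] at hly₂
    have hsq : (l y - c * (K.x₀ r * ρ)) * (l y + c * (K.x₀ r * ρ)) = 0 := by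
      have : l y * l y = c ^ 2 * K.x₀ r ^ 2 * (x₂ / x₁) := by
        field_simp
        linear_combination hly₂
      linear_combination this - c ^ 2 * K.x₀ r ^ 2 * hρ
    have hy : y = c • r + l y • e := by rw [← hc]; abel
    refine ⟨c, (mul_eq_zero.mp hsq).imp (fun h => ?_) (fun h => ?_)⟩
    · rw [sub_eq_zero.mp h] at hy
      rw [hy]; module
    · rw [eq_neg_of_add_eq_zero_left h] at hy
      rw [hy]; module

end Count

/-! ### Assembly of the double cover, and the proposition. -/

section Main

variable {V : Type*} [AddCommGroup V] [Module ℂ V]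

theorem IsSmoothFourfold.exists_doubleCover (hV : Module.finrank ℂ V = 5)
    {ω : Module.Dual ℂ (⋀[ℂ]^2 V)} {q : QuadraticForm ℂ (⋀[ℂ]^2 V)} (hX : IsSmoothFourfold ω q)
    {v : V} (hv0 : v ≠ 0) (hv : ∀ u, skew ω v u = 0)
    (hK : ∀ u, (∀ x, skew ω u x = 0) → u ∈ Submodule.span ℂ {v}) :
    ∃ φ : RationalMap (Fin 5 → ℂ) (⋀[ℂ]^2 V),
      φ.IsRationalDoubleCover (fourfold ω q) ∧
        IsBuiltFromLines φ (fourfold ω q) (sigmaQuadric v q) := by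
  have : Module.Finite ℂ V := Module.finite_of_finrank_pos (by omega)
  have hA := skew_self ω
  have hirr := hX.irreducible
  have hDex := hX.exists_discriminant_ne_zero hV hv0 hv hK
  obtain ⟨t, w, -, hD, ht⟩ := exists_independent_discriminant hA _ hDex
  obtain ⟨K, hg₁, hg₂, hg₃⟩ := exists_chart (q := q) hV hv hK ⟨t, ht⟩
  have hg₄ := genericallyNonzero_polarForm hv (hX.exists_gram_ne_zero hV hv0 hv hK)
  have p₁ : IsHomogeneousPolynomial 1 (fun η => K.x₁ (contract V K.x₀ η)) :=
    IsHomogeneousPolynomial.of_linear (K.x₁.comp (contract V K.x₀))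
  have p₂ : IsHomogeneousPolynomial 1 (fun η => K.x₂ (contract V K.x₀ η)) :=
    IsHomogeneousPolynomial.of_linear (K.x₂.comp (contract V K.x₀))
  have p₃ := homogeneous_contract (coneForm q v) K.x₀
  have p₄ := homogeneous_contract_linear (coneForm q v) (polarForm q v)
  have p₃₄ := p₃.mul p₄
  have hg₃₄ := hg₃.mul hirr p₃ p₄ hg₄
  have p₁₃₄ := p₁.mul p₃₄
  have hg₁₃₄ := hg₁.mul hirr p₁ p₃₄ hg₃₄
  -- A reducible cone is replaced by one of its hyperplanes with squared fibre coordinate; otherwise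
  -- it is projected from the point e₀, which is not in the radical.
  by_cases hlm : ∃ l m : Module.Dual ℂ V, ∀ u, coneForm q v u = l u * m u
  · obtain ⟨l, m, hlm⟩ := hlm
    have hlt : l t ≠ 0 := by
      intro h0
      exact ht (by rw [hlm, h0, zero_mul])
    have hu : IsHomogeneousMap 1 (fun y => y - l y • ((l t)⁻¹ • t)) :=
      IsHomogeneousMap.of_linear (LinearMap.id - l.smulRight ((l t)⁻¹ • t))
    have he : l ((l t)⁻¹ • t) = 1 := by
      rw [map_smul, smul_eq_mul, inv_mul_cancel₀ hlt]
    have hl := IsHomogeneousMap.of_linear l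
    refine FanoTen.exists_doubleCover hV hirr K hu
      (IsHomogeneousMap.smul (hu.linear_comp K.x₀) (hu.linear_comp K.x₀)) (hl.smul hl)
      (fun y => ?_) (p₂.mul p₁₃₄) (hg₂.mul hirr p₂ p₁₃₄ hg₁₃₄) fun a b hab hω hq hg => ?_
    · rw [← coneForm_apply, hlm, map_sub, map_smul, he, smul_eq_mul, mul_one, sub_self, zero_mul]
    · obtain ⟨h2, h⟩ := mul_ne_zero_iff.mp hg
      obtain ⟨h1, h⟩ := mul_ne_zero_iff.mp h
      obtain ⟨h3, h4⟩ := mul_ne_zero_iff.mp h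
      exact ⟨h1, K.count_of_hyperplane hlm he hab hω hq h1 h2 h3 h4⟩
  · obtain ⟨e₀, r, k, he₀, -, hr, -, -⟩ := exists_roots hD
    obtain ⟨f, hg₅⟩ := exists_genericallyNonzero_discriminant (q := q) hv hK hDex
    have hg₆ := genericallyNonzero_polar_root hv hK hlm he₀ hr
    have p₅ := homogeneous_contract_linear (coneForm q v)
      ((coneForm q v).polarBilin.comp (contract V f))
    have p₆ := homogeneous_contract (coneForm q v) ((coneForm q v).polarBilin e₀)
    have p₅₆ := p₅.mul p₆
    have hg₅₆ := hg₅.mul hirr p₅ p₆ hg₆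
    have he₀0 : e₀ ≠ 0 := by
      rintro rfl
      exact hr (by rw [map_zero, LinearMap.zero_apply])
    obtain ⟨τ, hτ⟩ := Module.Projective.exists_dual_eq_one ℂ he₀0
    have hid := IsHomogeneousMap.of_linear (LinearMap.id : V →ₗ[ℂ] V)
    have hf := IsHomogeneousMap.of_linear ((coneForm q v).polarBilin e₀)
    have hu : IsHomogeneousMap 2
        (fun y => coneForm q v y • e₀ - (coneForm q v).polarBilin e₀ y • y) :=
      ((hid.quadratic (coneForm q v)).linear_comp (LinearMap.toSpanSingleton ℂ V e₀)).sub
        (hf.smul hid)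
    refine FanoTen.exists_doubleCover hV hirr K hu hf (IsHomogeneousMap.of_linear τ)
      (fun y => ?_) (p₁₃₄.mul p₅₆) (hg₁₃₄.mul hirr p₁₃₄ p₅₆ hg₅₆) fun a b hab hω hq hg => ?_
    · rw [← coneForm_apply, quad_comb, he₀]; ring
    · obtain ⟨h, h'⟩ := mul_ne_zero_iff.mp hg
      obtain ⟨h1, h⟩ := mul_ne_zero_iff.mp h
      obtain ⟨h3, h4⟩ := mul_ne_zero_iff.mp h
      obtain ⟨h5, h6⟩ := mul_ne_zero_iff.mp h'
      rw [LinearMap.comp_apply, quad_contract_polar] at h5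
      exact ⟨h1, K.count_of_projection he₀ τ hτ hab hω hq h1 h3 h4 h6 (left_ne_zero_of_mul h5)⟩

end Main

end FanoTen

theorem proposition3p1 {V : Type*} [AddCommGroup V] [Module ℂ V]
    (hV : Module.finrank ℂ V = 5)
    (ω : Module.Dual ℂ (⋀[ℂ]^2 V)) (q : QuadraticForm ℂ (⋀[ℂ]^2 V))
    (hX : FanoTen.IsSmoothFourfold ω q) :
    FanoTen.IsUnirational (FanoTen.fourfold ω q) ∧
    ∃ v : V, FanoTen.SpansKernel ω v ∧
      FanoTen.sigmaQuadric v q ⊆ FanoTen.fourfold ω q ∧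
      (∃ η ∈ FanoTen.star v, q η ≠ 0) ∧
      (∀ S : Set (ℙ ℂ (⋀[ℂ]^2 V)), FanoTen.IsIrreducibleSigmaQuadric S →
        S ⊆ FanoTen.fourfold ω q → S = FanoTen.sigmaQuadric v q) ∧
      ∃ φ : FanoTen.RationalMap (Fin 5 → ℂ) (⋀[ℂ]^2 V),
        φ.IsRationalDoubleCover (FanoTen.fourfold ω q) ∧
        FanoTen.IsBuiltFromLines φ (FanoTen.fourfold ω q) (FanoTen.sigmaQuadric v q) := by
  obtain ⟨v, hv0, hv, hK⟩ := hX.exists_kernel hV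
  obtain ⟨φ, hφ, hlines⟩ := hX.exists_doubleCover hV hv0 hv hK
  obtain ⟨t, -, -, -, ht⟩ := FanoTen.exists_independent_discriminant (FanoTen.skew_self ω) _
    (hX.exists_discriminant_ne_zero hV hv0 hv hK)
  have hstar : ∃ η ∈ FanoTen.star v, q η ≠ 0 :=
    ⟨FanoTen.wedge v t, FanoTen.mem_star.mpr ⟨t, rfl⟩, ht⟩
  refine ⟨⟨4, φ, hφ.1⟩, v, ⟨hv0, fun u => ⟨hK u, fun hu w => ?_⟩⟩,
    FanoTen.sigmaQuadric_subset_fourfold q hv, hstar,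
    fun S hS hSX => FanoTen.eq_sigmaQuadric hK hstar hS hSX, φ, hφ, hlines⟩
  obtain ⟨c, rfl⟩ := Submodule.mem_span_singleton.mp hu
  rw [FanoTen.wedge_smul_left, map_smul, ← FanoTen.skew_apply, hv, smul_zero]
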